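/- Random phone call model. Let $V$ be a set of $n\ge 2$ nodes and let $k\ge 0$. Every node $v$ initially knows a set $A_v\subseteq\{1,\dots,k\}$ of messages, where each message is known to at least one node; apart from this the initial distribution $A=(A_v)_{v\in V}$ is arbitrary. RLNC gossip with $q=2$ keeps at each node $v$ a subspace $Y_v\subseteq\mathbb F_2^k$ of coefficient vectors, initially $Y_v=\operatorname{span}\{e_i : i\in A_v\}$. In each synchronous round every node calls a uniformly random other node, independently of all other choices. In the PUSH model each caller sends a packet to the node it calls, in the PULL model each called node sends a packet to its caller, and in the EXCHANGE model both happen. A packet sent by $u$ is a uniformly random element of the current $Y_u$, independent of the calls and of the packets of other nodes; a node that sends over several links in one round either uses one and the same random packet for all of them, or independent packets for different links (the result holds under both conventions). At the end of the round every node adds all received vectors to its subspace and takes the span. Let $T$ be the first time $t\in\{0,1,2,\dots\}$ at which $Y_v=\mathbb F_2^k$ for all nodes $v$, i.e. at which every node can decode all $k$ messages. Then in each of the models PUSH, PULL and EXCHANGE, and under each of the two packet conventions, $T=\Theta(k+\log n)$ with high probability, in the following sense. 1. (Upper bound, for every initial distribution.) For every $a>0$ there is a constant $C>0$, depending only on $a$,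 such that for all $n\ge 2$, all $k\ge 0$, every initial distribution $A$ and every integer $t\ge C(k+\log n)$, $$\Pr[T\le t]\ \ge\ 1-n^{-a}.$$ 2. (Lower bound, for every initial distribution in which the messages are not already spread.) For every $a>0$ and every $\alpha>0$ there is a constant $c>0$, depending only on $a$ and $\alpha$, such that for all $n\ge2$ and $k\ge 0$, and for every initial distribution $A$ in which some node does not know at least $\alpha k$ of the messages and some message is unknown to at least $\alpha n$ of the nodes, for every integer $0\le t<c(k+\log n)$, $$\Pr[T\le t]\ \le\ n^{-a}.$$ In particular (with $\alpha=1/2$), for $k\ge1$ the lower bound applies when all messages are initially known to one single node only. -/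

import Mathlib

/-- The three kinds of calls in the random phone call model. -/
inductive CallMode where
  | push
  | pull
  | exchange

/-- How the packets that one node sends in one round are related. With `perNode` a node prepares a
single random packet in each round and hands this packet to everybody it transmits to in that round;
with `perLink` it draws a fresh random packet for every link over which it transmits. -/
inductive PacketRule where
  | perNode
  | perLink

/-- A state of the protocol: every node holds the subspace of `F ^ k` that is spanned by the
coefficient vectors of the packets it knows. -/
abbrev GossipState (V F : Type) [Field F] (k : ℕ) : Type :=
  V → Submodule F (Fin k → F)

/-- The state at the beginning: node `v` knows the messages with indices in `A v`, and the
coefficient vector of message `i` is the `i`-th standard basis vector. -/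
def initialState {V : Type} (F : Type) [Field F] {k : ℕ} (A : V → Set (Fin k)) :
    GossipState V F k :=
  fun v => Submodule.span F {x | ∃ i ∈ A v, x = Pi.single i 1}

/-- All random choices of one round. The first component says whom each node calls (some other
node of the complete graph); the second one holds, for each pair `(u, v)`, a packet that `u` draws
from its current subspace. -/
abbrev RoundChoice {V F : Type} [Field F] {k : ℕ} (Y : GossipState V F k) : Type :=
  (∀ u : V, {v : V // v ≠ u}) × (∀ l : V × V, Y l.1)

instance roundChoice_nonempty {V F : Type} [Nontrivial V] [Field F] {k : ℕ}
    (Y : GossipState V F k) : Nonempty (RoundChoice Y) :=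
  ⟨(fun u => ⟨(exists_ne u).choose, (exists_ne u).choose_spec⟩, fun _ => 0)⟩

/-- Whether a packet travels from `u` to `v`, where `c` says whom each node calls. -/
def Transmits {V : Type} (mode : CallMode) (c : ∀ u : V, {v : V // v ≠ u}) (u v : V) : Prop :=
  match mode with
  | .push => (c u : V) = v
  | .pull => (c v : V) = u
  | .exchange => (c u : V) = v ∨ (c v : V) = u

/-- The coefficient vector of the packet that travels from `u` to `v`, if one does. -/
def sentPacket {V F : Type} [Field F] {k : ℕ} (rule : PacketRule) {Y : GossipState V F k}
    (p : ∀ l : V × V, Y l.1) (u v : V) : Fin k → F :=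
  match rule with
  | .perNode => (p (u, u) : Fin k → F)
  | .perLink => (p (u, v) : Fin k → F)

/-- The state after a round: all received packets are added to the subspaces. -/
def nextState {V F : Type} [Field F] {k : ℕ} (mode : CallMode) (rule : PacketRule)
    (Y : GossipState V F k) (ω : RoundChoice Y) : GossipState V F k :=
  fun v => Y v ⊔ Submodule.span F {x | ∃ u, Transmits mode ω.1 u v ∧ x = sentPacket rule ω.2 u v}

/-- The law of the state after one round from the state `Y`. The uniform distribution on the finite
product `RoundChoice Y` makes all calls uniform over the other nodes, each packet uniform over the
subspace of its sender, and all these choices independent. -/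
noncomputable def roundLaw {V F : Type} [Fintype V] [Nontrivial V] [Field F] [Fintype F] {k : ℕ}
    (mode : CallMode) (rule : PacketRule) (Y : GossipState V F k) : PMF (GossipState V F k) :=
  haveI : Fintype (RoundChoice Y) := Fintype.ofFinite _
  (PMF.uniformOfFintype (RoundChoice Y)).map (nextState mode rule Y)

/-- The law of the state after `t` synchronous rounds, with fresh randomness in each round. -/
noncomputable def stateLaw {V F : Type} [Fintype V] [Nontrivial V] [Field F] [Fintype F] {k : ℕ}
    (mode : CallMode) (rule : PacketRule) (Y₀ : GossipState V F k) : ℕ → PMF (GossipState V F k)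
  | 0 => PMF.pure Y₀
  | t + 1 => (stateLaw mode rule Y₀ t).bind (roundLaw mode rule)

/-- The probability that after `t` rounds every node can decode all `k` messages, i.e. that the
subspace of every node is the full space. Subspaces never shrink, so this is the probability that
the stopping time of the protocol is at most `t`. -/
noncomputable def spreadProb {V : Type} (F : Type) [Fintype V] [Nontrivial V] [Field F] [Fintype F]
    {k : ℕ} (mode : CallMode) (rule : PacketRule) (A : V → Set (Fin k)) (t : ℕ) : ℝ :=
  ((stateLaw mode rule (initialState F A) t).toOuterMeasure {Y | ∀ v, Y v = ⊤}).toReal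

/-!
The proof follows the spreading of linear functionals. For a nonzero functional `φ` on `𝔽₂ ^ k` call a
node ignorant if its subspace lies in the kernel of `φ`, and informed otherwise. All nodes can decode
everything if and only if no node is ignorant of any nonzero `φ`. A packet of an informed node is
nonzero under `φ` with probability exactly one half, so each `φ` spreads like a rumour that gets lost
on its way with probability one half.

*Upper bound.* For fixed `φ` let `U` and `I` be the sets of ignorant and of informed nodes. The ratio
`|U| / |I|` shrinks in expectation by a constant factor in every round
(`stepMean_ignoranceRatio_le`): as long as `|I| ≤ |U|`, the set `I` grows by a constant factor in
expectation even after truncation at twice its size, which makes `n / |I|` decrease; afterwards each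
ignorant node is informed with constant probability. Initially the ratio is at most `n`, and it is at
least `1 / n` as long as some node is ignorant, so the failure probability for `φ` decays like
`n ^ 2 * (15 / 16) ^ t`. A union bound over the `2 ^ k` functionals (`one_sub_spreadProb_le`) costs a
time proportional to `k` only.

*Lower bound, `log n ≤ k`.* A node lacking `α k` messages has to receive that many packets. The number
of packets that it receives in a round is at most one more than the number of calls to it, which has
bounded exponential moments, so `exp (b * finrank (Y v))` grows at most by a constant factor per round
(`spreadProb_le_exp_finrank`).

*Lower bound, `k < log n`.* For a coordinate functional with `|U| ≥ α n` initially, an ignorant node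
stays ignorant if nobody calls it and the packet that it would pull is annihilated by `φ`. This happens
to a constant fraction of `U` with exponential concentration: `E exp (-r |U'|) ≤ exp (-r δ |U|)` for
a constant `δ` and `0 ≤ r ≤ 1 / 4` (`stepMean_exp_ignorant_le`). The calls are not independent of each
other in their effect on different nodes, so they are exposed one at a time, with a weight for every
node that records the conditional probability of survival (`mean_exp_exposedWeight_insert_le`).
Iteration gives the bound `exp (-δ ^ t * α n / 4)`, which is tiny when `t` is a small multiple of
`log n`.
-/

/-! ### Indicators and averages over finite types -/

/-- The indicator of a proposition, as a real number. -/
noncomputable def ind (P : Prop) : ℝ :=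
  open Classical in if P then 1 else 0

lemma ind_of_true {P : Prop} (h : P) : ind P = 1 := if_pos h

lemma ind_of_false {P : Prop} (h : ¬ P) : ind P = 0 := if_neg h

lemma ind_nonneg (P : Prop) : 0 ≤ ind P := by
  by_cases h : P
  · simp [ind_of_true h]
  · simp [ind_of_false h]

lemma ind_le_one (P : Prop) : ind P ≤ 1 := by
  by_cases h : P
  · simp [ind_of_true h]
  · simp [ind_of_false h]

lemma ind_mono {P Q : Prop} (h : P → Q) : ind P ≤ ind Q := by
  by_cases hP : P
  · rw [ind_of_true hP, ind_of_true (h hP)]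
  · rw [ind_of_false hP]
    exact ind_nonneg Q

lemma ind_not (P : Prop) : ind (¬ P) = 1 - ind P := by
  by_cases h : P
  · rw [ind_of_false (not_not.2 h), ind_of_true h, sub_self]
  · rw [ind_of_true h, ind_of_false h, sub_zero]

lemma sum_ind {α : Type*} (s : Finset α) (P : α → Prop) [DecidablePred P] :
    ∑ i ∈ s, ind (P i) = (s.filter P).card := by
  rw [← Finset.sum_boole]
  refine Finset.sum_congr rfl fun i _ => ?_
  by_cases h : P i
  · rw [ind_of_true h, if_pos h]
  · rw [ind_of_false h, if_neg h]

/-- The average of a real function over a finite type. It is phrased with `finsum` and `Nat.card`, so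
that no choice of a `Fintype` instance enters; the value is junk unless the type is finite. -/
noncomputable def mean {α : Type*} (f : α → ℝ) : ℝ := (∑ᶠ i, f i) / Nat.card α

section Mean

variable {α β : Type*}

lemma mean_eq [Fintype α] (f : α → ℝ) : mean f = (∑ i, f i) / Fintype.card α := by
  rw [mean, finsum_eq_sum_of_fintype, Nat.card_eq_fintype_card]

lemma mean_mono [Finite α] {f g : α → ℝ} (h : ∀ i, f i ≤ g i) : mean f ≤ mean g := by
  have := Fintype.ofFinite α
  rw [mean_eq, mean_eq]
  gcongr with i
  exact h i

lemma mean_const [Finite α] [Nonempty α] (c : ℝ) : mean (fun _ : α => c) = c := by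
  have := Fintype.ofFinite α
  have : (Fintype.card α : ℝ) ≠ 0 := by simp
  rw [mean_eq]
  simp [this]

lemma mean_nonneg [Finite α] {f : α → ℝ} (h : ∀ i, 0 ≤ f i) : 0 ≤ mean f := by
  have := Fintype.ofFinite α
  rw [mean_eq]
  exact div_nonneg (Finset.sum_nonneg fun i _ => h i) (by positivity)

lemma mean_add [Finite α] (f g : α → ℝ) : mean (fun i => f i + g i) = mean f + mean g := by
  have := Fintype.ofFinite α
  simp only [mean_eq, Finset.sum_add_distrib, add_div]

lemma mean_sub [Finite α] (f g : α → ℝ) : mean (fun i => f i - g i) = mean f - mean g := by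
  have := Fintype.ofFinite α
  simp only [mean_eq, Finset.sum_sub_distrib, sub_div]

lemma mean_const_mul [Finite α] (c : ℝ) (f : α → ℝ) :
    mean (fun i => c * f i) = c * mean f := by
  have := Fintype.ofFinite α
  simp only [mean_eq, ← Finset.mul_sum, mul_div_assoc]

lemma mean_sum [Finite α] {ι : Type*} (s : Finset ι) (f : ι → α → ℝ) :
    mean (fun i => ∑ j ∈ s, f j i) = ∑ j ∈ s, mean (f j) := by
  have := Fintype.ofFinite α
  simp only [mean_eq, ← Finset.sum_div]
  rw [Finset.sum_comm]

lemma mean_prod [Finite α] [Finite β] (f : α × β → ℝ) :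
    mean f = mean fun a => mean fun b => f (a, b) := by
  have := Fintype.ofFinite α
  have := Fintype.ofFinite β
  simp only [mean_eq, ← Finset.sum_div, Fintype.sum_prod_type, Fintype.card_prod, Nat.cast_mul]
  rw [div_div, mul_comm]

lemma mean_comm [Finite α] [Finite β] (f : α → β → ℝ) :
    (mean fun a => mean fun b => f a b) = mean fun b => mean fun a => f a b := by
  have := Fintype.ofFinite α
  have := Fintype.ofFinite β
  simp only [mean_eq, ← Finset.sum_div]
  rw [Finset.sum_comm, div_div, div_div, mul_comm]

lemma mean_equiv (e : α ≃ α) (f : α → ℝ) : mean (fun i => f (e i)) = mean f := by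
  rw [mean, mean, finsum_comp_equiv e]

/-- The expectation of a product of functions of independent variables factors. -/
lemma mean_pi_prod {ι : Type*} [Fintype ι] {β : ι → Type*} [∀ i, Finite (β i)]
    (g : ∀ i, β i → ℝ) : mean (fun c : ∀ i, β i => ∏ i, g i (c i)) = ∏ i, mean (g i) := by
  classical
  have := fun i => Fintype.ofFinite (β i)
  simp only [mean_eq, Finset.prod_div_distrib, Finset.prod_univ_sum, Fintype.piFinset_univ,
    Fintype.card_pi, Nat.cast_prod]

/-- Redrawing one coordinate of a uniformly random element of a product does not change its law. -/
lemma mean_update {ι : Type*} [Finite ι] [DecidableEq ι] {β : ι → Type*} [∀ i, Finite (β i)]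
    [∀ i, Nonempty (β i)] (u : ι) (h : (∀ i, β i) → ℝ) :
    mean h = mean fun c => mean fun x : β u => h (Function.update c u x) := by
  -- exchanging the old and the new value of the coordinate is an involution
  let e : ((∀ i, β i) × β u) ≃ ((∀ i, β i) × β u) :=
    Function.Involutive.toPerm (fun q => (Function.update q.1 u q.2, q.1 u)) (by
      rintro ⟨c, x⟩
      simp)
  have h1 := mean_equiv e (fun q => h q.1)
  rw [mean_prod, mean_prod] at h1
  simp only [mean_const] at h1
  exact h1.symm

lemma mean_coord {ι : Type*} [Finite ι] {β : ι → Type*} [∀ i, Finite (β i)]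
    [∀ i, Nonempty (β i)] (u : ι) (g : β u → ℝ) :
    mean (fun c : ∀ i, β i => g (c u)) = mean g := by
  classical
  rw [mean_update u]
  simp [mean_const]

end Mean

/-! ### The transition operator -/

lemma le_nextState {V F : Type} [Field F] {k : ℕ} (mode : CallMode) (rule : PacketRule)
    (Y : GossipState V F k) (ω : RoundChoice Y) : Y ≤ nextState mode rule Y ω :=
  fun _ => le_sup_left

section Operator

variable {V F : Type} [Fintype V] [Field F] [Fintype F] {k : ℕ}

/-- The transition operator of the protocol: the expected value of `f` after one round from `Y`. -/
noncomputable def stepMean (mode : CallMode) (rule : PacketRule) (f : GossipState V F k → ℝ)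
    (Y : GossipState V F k) : ℝ :=
  mean fun ω : RoundChoice Y => f (nextState mode rule Y ω)

lemma stepMean_nonneg (mode : CallMode) (rule : PacketRule) {f : GossipState V F k → ℝ}
    (hf : ∀ Z, 0 ≤ f Z) (Y : GossipState V F k) : 0 ≤ stepMean mode rule f Y :=
  mean_nonneg fun _ => hf _

/-- Iterating the transition operator against time-dependent potentials, on a class `P` of states
that the protocol cannot leave. -/
lemma iterate_stepMean_le (mode : CallMode) (rule : PacketRule) (P : GossipState V F k → Prop)
    (hP : ∀ Y ω, P Y → P (nextState mode rule Y ω)) (f : GossipState V F k → ℝ)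
    (g : ℕ → GossipState V F k → ℝ) (h0 : ∀ Y, P Y → f Y ≤ g 0 Y)
    (hg : ∀ s Y, P Y → stepMean mode rule (g s) Y ≤ g (s + 1) Y) (t : ℕ) :
    ∀ Y, P Y → (stepMean mode rule)^[t] f Y ≤ g t Y := by
  induction t with
  | zero => exact h0
  | succ t ih =>
    intro Y hY
    rw [Function.iterate_succ_apply']
    exact (mean_mono fun ω => ih _ (hP Y ω hY)).trans (hg t Y hY)

variable [Nontrivial V]

lemma PMF.tsum_pure_mul {α : Type*} (a : α) (g : α → ENNReal) :
    ∑' x, PMF.pure a x * g x = g a := by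
  rw [tsum_eq_single a]
  · simp
  · intro b hb
    simp [PMF.pure_apply, hb]

lemma PMF.tsum_bind_mul {α β : Type*} (p : PMF α) (q : α → PMF β) (g : β → ENNReal) :
    ∑' y, p.bind q y * g y = ∑' x, p x * ∑' y, q x y * g y := by
  simp only [PMF.bind_apply, ← ENNReal.tsum_mul_right, ← ENNReal.tsum_mul_left]
  rw [ENNReal.tsum_comm]
  simp only [mul_assoc]

lemma tsum_roundLaw_mul (mode : CallMode) (rule : PacketRule) (Y : GossipState V F k)
    {f : GossipState V F k → ℝ} (hf : ∀ Z, 0 ≤ f Z) :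
    ∑' Z, roundLaw mode rule Y Z * ENNReal.ofReal (f Z) =
      ENNReal.ofReal (stepMean mode rule f Y) := by
  let _ : Fintype (RoundChoice Y) := Fintype.ofFinite _
  have hc : (0 : ℝ) < Fintype.card (RoundChoice Y) := by exact_mod_cast Fintype.card_pos
  rw [roundLaw, PMF.map, PMF.tsum_bind_mul, stepMean, mean_eq]
  simp only [Function.comp_apply, PMF.tsum_pure_mul, PMF.uniformOfFintype_apply, tsum_fintype]
  rw [← Finset.mul_sum, ENNReal.ofReal_div_of_pos hc, ENNReal.ofReal_natCast,
    ENNReal.ofReal_sum_of_nonneg fun i _ => hf _, ENNReal.div_eq_inv_mul]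

lemma tsum_stateLaw_mul (mode : CallMode) (rule : PacketRule) (Y₀ : GossipState V F k) (t : ℕ)
    {f : GossipState V F k → ℝ} (hf : ∀ Z, 0 ≤ f Z) :
    ∑' Z, stateLaw mode rule Y₀ t Z * ENNReal.ofReal (f Z) =
      ENNReal.ofReal ((stepMean mode rule)^[t] f Y₀) := by
  induction t generalizing f with
  | zero => simp [stateLaw]
  | succ t ih =>
    rw [stateLaw, PMF.tsum_bind_mul, Function.iterate_succ_apply,
      ← ih fun Z => stepMean_nonneg mode rule hf Z]
    simp only [tsum_roundLaw_mul mode rule _ hf]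

/-- The success probability is obtained by iterating the transition operator on an indicator. All
later estimates are about this operator and do not mention `PMF`. -/
lemma spreadProb_eq_iterate (mode : CallMode) (rule : PacketRule) (A : V → Set (Fin k)) (t : ℕ) :
    spreadProb F mode rule A t =
      (stepMean mode rule)^[t] (fun Y => ind (∀ v, Y v = ⊤)) (initialState F A) := by
  have h0 : ∀ Y : GossipState V F k, 0 ≤ ind (∀ v, Y v = ⊤) :=
    fun Y => ind_nonneg _
  have h1 : 0 ≤ (stepMean mode rule)^[t] (fun Y => ind (∀ v, Y v = ⊤))
      (initialState F A) := by
    suffices ∀ f : GossipState V F k → ℝ, (∀ Z, 0 ≤ f Z) →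
        ∀ Y, 0 ≤ (stepMean mode rule)^[t] f Y from this _ h0 _
    induction t with
    | zero => exact fun f hf => hf
    | succ t ih => exact fun f hf => ih _ (stepMean_nonneg mode rule hf)
  rw [spreadProb, ← ENNReal.toReal_ofReal h1, ← tsum_stateLaw_mul mode rule _ t h0,
    PMF.toOuterMeasure_apply]
  congr 1
  refine tsum_congr fun Y => ?_
  by_cases h : ∀ v, Y v = ⊤ <;> simp [Set.indicator, ind, h]

lemma iterate_stepMean_one_sub (mode : CallMode) (rule : PacketRule) (f : GossipState V F k → ℝ)
    (t : ℕ) : (stepMean mode rule)^[t] (fun Y => 1 - f Y) =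
      fun Y => 1 - (stepMean mode rule)^[t] f Y := by
  induction t with
  | zero => rfl
  | succ t ih =>
    rw [Function.iterate_succ_apply', Function.iterate_succ_apply', ih]
    funext Y
    rw [stepMean, mean_sub, mean_const]
    rfl

end Operator

/-! ### Spreading of a functional -/

section Ignorant

variable {V : Type} [Fintype V] {k : ℕ}

open Classical in
/-- The nodes all of whose vectors are annihilated by the functional `φ`. A node decodes everything
exactly when it is ignorant of no nonzero functional. -/
noncomputable def ignorant {F : Type} [Field F] (φ : Module.Dual F (Fin k → F))
    (Y : GossipState V F k) : Finset V :=
  Finset.univ.filter fun v => Y v ≤ LinearMap.ker φ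

lemma mem_ignorant {F : Type} [Field F] {φ : Module.Dual F (Fin k → F)} {Y : GossipState V F k}
    {v : V} : v ∈ ignorant φ Y ↔ Y v ≤ LinearMap.ker φ := by
  simp [ignorant]

/-- An ignorant node stays ignorant exactly when it receives only packets annihilated by `φ`. -/
lemma mem_ignorant_nextState {F : Type} [Field F] {φ : Module.Dual F (Fin k → F)}
    {Y : GossipState V F k} {mode : CallMode} {rule : PacketRule} {ω : RoundChoice Y} {v : V} :
    v ∈ ignorant φ (nextState mode rule Y ω) ↔
      v ∈ ignorant φ Y ∧ ∀ u, Transmits mode ω.1 u v → φ (sentPacket rule ω.2 u v) = 0 := by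
  simp only [mem_ignorant, nextState, sup_le_iff, Submodule.span_le, and_congr_right_iff]
  intro _
  constructor
  · intro h u hu
    exact h ⟨u, hu, rfl⟩
  · rintro h _ ⟨u, hu, rfl⟩
    exact h u hu

lemma ignorant_anti {F : Type} [Field F] {φ : Module.Dual F (Fin k → F)}
    {Y Z : GossipState V F k} (h : Y ≤ Z) : ignorant φ Z ⊆ ignorant φ Y := by
  intro v
  simp only [mem_ignorant]
  exact (h v).trans

/-- Over `𝔽₂` a functional that does not vanish on a subspace is nonzero at exactly half of its
vectors: translation by a vector where it is `1` swaps its two fibres. -/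
lemma mean_ne_zero {M : Type*} [AddCommGroup M] [Module (ZMod 2) M] (S : Submodule (ZMod 2) M)
    [Finite S] (φ : Module.Dual (ZMod 2) M) (h : ¬ S ≤ LinearMap.ker φ) :
    mean (fun x : S => ind (φ x ≠ 0)) = 1 / 2 := by
  obtain ⟨x₀, hx₀, h₀⟩ := SetLike.not_le_iff_exists.1 h
  have h1 := mean_equiv (Equiv.addRight (⟨x₀, hx₀⟩ : S))
    (fun x : S => ind (φ x ≠ 0))
  have h2 : (fun x : S => ind (φ (Equiv.addRight (⟨x₀, hx₀⟩ : S) x : S) ≠ 0)) =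
      fun x : S => 1 - ind (φ x ≠ 0) := by
    funext x
    have key : ∀ a b : ZMod 2, b ≠ 0 → (a + b ≠ 0 ↔ ¬ a ≠ 0) := by decide
    have hk := key (φ x) (φ x₀) (by simpa using h₀)
    rw [← ind_not, ← hk]
    simp
  rw [h2, mean_sub, mean_const] at h1
  linarith

lemma mean_sentPacket_ne_zero (rule : PacketRule) {φ : Module.Dual (ZMod 2) (Fin k → ZMod 2)}
    {Y : GossipState V (ZMod 2) k} {u : V} (v : V) (hu : u ∉ ignorant φ Y) :
    mean (fun p : ∀ l : V × V, Y l.1 =>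
      ind (φ (sentPacket rule p u v) ≠ 0)) = 1 / 2 := by
  rw [mem_ignorant] at hu
  cases rule
  · exact (mean_coord (β := fun l : V × V => Y l.1) (u, u)
      (fun x => ind (φ x ≠ 0))).trans (mean_ne_zero _ _ hu)
  · exact (mean_coord (β := fun l : V × V => Y l.1) (u, v)
      (fun x => ind (φ x ≠ 0))).trans (mean_ne_zero _ _ hu)

end Ignorant

/-! ### Uniform calls -/

section Calls

variable {V : Type} [Fintype V] [Nontrivial V]

instance callTarget_nonempty (u : V) : Nonempty {v : V // v ≠ u} :=
  let ⟨v, hv⟩ := exists_ne u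
  ⟨⟨v, hv⟩⟩

variable (V) in
lemma one_le_card_sub_one : (1 : ℝ) ≤ Fintype.card V - 1 := by
  have : (2 : ℝ) ≤ Fintype.card V := by exact_mod_cast Fintype.one_lt_card (α := V)
  linarith

open Classical in
lemma mean_callTarget (u : V) (g : V → ℝ) :
    mean (fun w : {v : V // v ≠ u} => g w) =
      (∑ w ∈ Finset.univ.erase u, g w) / (Fintype.card V - 1) := by
  rw [mean_eq]
  congr 1
  · exact (Finset.sum_subtype _ (by simp) g).symm
  · rw [Fintype.card_subtype_compl, Fintype.card_subtype_eq,
      Nat.cast_sub Fintype.card_pos, Nat.cast_one]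

open Classical in
lemma mean_callTarget_eq {u v : V} (h : u ≠ v) (r : ℝ) :
    mean (fun w : {w : V // w ≠ u} => if (w : V) = v then r else 1) =
      1 + (r - 1) / (Fintype.card V - 1) := by
  have hn := one_le_card_sub_one V
  have h1 : (fun w : {w : V // w ≠ u} => if (w : V) = v then r else 1) =
      fun w : {w : V // w ≠ u} => 1 + (r - 1) * if (w : V) = v then 1 else 0 := by
    funext w
    split_ifs <;> ring
  rw [h1, mean_add, mean_const, mean_const_mul, mean_callTarget u fun w => if w = v then 1 else 0]
  simp [h.symm, div_eq_mul_inv]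

open Classical in
/-- The probability that a given node `v` is called from a set `G` of other nodes is at least half
the expected number of such calls. -/
lemma le_mean_exists_call {v : V} {G : Finset V} (hG : v ∉ G) :
    (G.card : ℝ) / (2 * (Fintype.card V - 1)) ≤
      mean (fun c : ∀ u : V, {w : V // w ≠ u} => ind (∃ u ∈ G, (c u : V) = v)) := by
  have hn := one_le_card_sub_one V
  set N : ℝ := Fintype.card V - 1 with hN
  have hGc : (G.card : ℝ) ≤ N := by
    have : G.card + 1 ≤ Fintype.card V := by
      rw [← Finset.card_insert_of_notMem hG]
      exact Finset.card_le_univ _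
    have : (G.card : ℝ) + 1 ≤ Fintype.card V := by exact_mod_cast this
    linarith
  have h1 : (fun c : ∀ u : V, {w : V // w ≠ u} =>
      ind (∃ u ∈ G, (c u : V) = v)) =
      fun c => 1 - ∏ u, if u ∈ G then (if (c u : V) = v then (0 : ℝ) else 1) else 1 := by
    funext c
    by_cases h : ∃ u ∈ G, (c u : V) = v
    · obtain ⟨u, hu, hc⟩ := h
      rw [ind_of_true ⟨u, hu, hc⟩,
        Finset.prod_eq_zero (Finset.mem_univ u) (by simp [hu, hc]), sub_zero]
    · rw [ind_of_false h, Finset.prod_eq_one, sub_self]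
      intro u _
      push Not at h
      by_cases hu : u ∈ G
      · simp [hu, h u hu]
      · simp [hu]
  have h2 : ∀ u, mean (fun w : {w : V // w ≠ u} =>
      if u ∈ G then (if (w : V) = v then (0 : ℝ) else 1) else 1) =
      if u ∈ G then 1 - 1 / N else 1 := by
    intro u
    by_cases hu : u ∈ G
    · simp only [hu, if_true]
      rw [mean_callTarget_eq (fun h : u = v => hG (by rw [← h]; exact hu))]
      ring
    · simp only [hu, if_false]
      exact mean_const _
  rw [h1, mean_sub, mean_const,
    mean_pi_prod (β := fun u => {w : V // w ≠ u})
      (fun u w => if u ∈ G then (if (w : V) = v then (0 : ℝ) else 1) else 1)]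
  simp only [h2, Finset.prod_ite_mem, Finset.univ_inter, Finset.prod_const]
  -- `(1 - x)^g ≤ 1 / (1 + x)^g ≤ 1 / (1 + g x) ≤ 1 - g x / 2`
  set g := G.card
  have hx0 : 0 < 1 / N := by positivity
  have hx1 : 1 / N ≤ 1 := by rw [div_le_one (by linarith)]; exact hn
  have hgx : (g : ℝ) * (1 / N) ≤ 1 := by
    rw [mul_one_div, div_le_one (by linarith)]; exact hGc
  have hgx0 : 0 ≤ (g : ℝ) * (1 / N) := by positivity
  have hb : 1 + (g : ℝ) * (1 / N) ≤ (1 + 1 / N) ^ g := one_add_mul_le_pow (by linarith) g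
  have hm : (1 - 1 / N) ^ g * (1 + 1 / N) ^ g ≤ 1 := by
    rw [← mul_pow]
    exact pow_le_one₀ (mul_nonneg (by linarith) (by linarith)) (by nlinarith)
  have hp : 0 ≤ (1 - 1 / N) ^ g := pow_nonneg (by linarith) g
  have hgoal : (g : ℝ) / (2 * N) = (g : ℝ) * (1 / N) / 2 := by
    field_simp
  rw [hgoal]
  generalize (g : ℝ) * (1 / N) = y at *
  generalize (1 - 1 / N) ^ g = P at *
  generalize (1 + 1 / N) ^ g = Q at *
  have : P * (1 + y) ≤ 1 := le_trans (mul_le_mul_of_nonneg_left hb hp) hm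
  by_contra hcon
  push Not at hcon
  nlinarith

open Classical in
lemma mean_call_mem {v : V} {G : Finset V} (hG : v ∉ G) :
    mean (fun c : ∀ u : V, {w : V // w ≠ u} => ind ((c v : V) ∈ G)) =
      G.card / (Fintype.card V - 1) := by
  rw [mean_coord (β := fun u => {w : V // w ≠ u}) v (fun w => ind ((w : V) ∈ G)),
    mean_callTarget v fun w => ind (w ∈ G)]
  congr 1
  rw [sum_ind, Finset.filter_mem_eq_inter, Finset.inter_eq_right.2]
  intro w hw
  simp only [Finset.mem_erase, Finset.mem_univ, and_true]
  rintro rfl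
  exact hG hw

end Calls

/-! ### The upper bound -/

section Upper

variable {V : Type} [Fintype V] {k : ℕ}

lemma notMem_ignorant_nextState {φ : Module.Dual (ZMod 2) (Fin k → ZMod 2)}
    {Y : GossipState V (ZMod 2) k} {mode : CallMode} {rule : PacketRule} {ω : RoundChoice Y}
    {u v : V} (h : Transmits mode ω.1 u v) (h' : φ (sentPacket rule ω.2 u v) ≠ 0) :
    v ∉ ignorant φ (nextState mode rule Y ω) := by
  rw [mem_ignorant_nextState]
  exact fun hv => h' (hv.2 u h)

variable [Nontrivial V]

open Classical in
/-- If the packets of the nodes in `S` are good with probability one half each, then `w` is called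
from `S` by a node with a good packet with probability at least `|S| / (4 (n - 1))`. No independence
of the packets is needed, as the bound for fixed packets is linear in the number of good ones. -/
lemma le_mean_exists_good_call (Y : GossipState V (ZMod 2) k) {w : V} {S : Finset V} (hw : w ∉ S)
    (good : (∀ l : V × V, Y l.1) → V → Prop)
    (hgood : ∀ s ∈ S, mean (fun p => ind (good p s)) = 1 / 2) :
    (S.card : ℝ) / (4 * (Fintype.card V - 1)) ≤
      mean (fun ω : RoundChoice Y =>
        ind (∃ s ∈ S, good ω.2 s ∧ (ω.1 s : V) = w)) := by
  have hn := one_le_card_sub_one V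
  rw [mean_prod, mean_comm]
  have h1 : ∀ p, (1 / (2 * ((Fintype.card V : ℝ) - 1))) * (∑ s ∈ S, ind (good p s))
      ≤ mean fun c : ∀ u : V, {w : V // w ≠ u} =>
        ind (∃ s ∈ S, good p s ∧ (c s : V) = w) := by
    intro p
    have hG : w ∉ S.filter (good p) := fun h => hw (Finset.mem_filter.1 h).1
    refine le_trans (le_of_eq ?_) ((le_mean_exists_call hG).trans (mean_mono fun c =>
      ind_mono ?_))
    · rw [sum_ind, one_div_mul_eq_div]
    · rintro ⟨u, hu, hc⟩
      exact ⟨u, (Finset.mem_filter.1 hu).1, (Finset.mem_filter.1 hu).2, hc⟩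
  refine le_trans (le_of_eq ?_) (mean_mono h1)
  rw [mean_const_mul, mean_sum, Finset.sum_congr rfl hgood, Finset.sum_const, nsmul_eq_mul]
  field_simp
  norm_num

open Classical in
/-- An ignorant node becomes informed with probability at least a quarter of the fraction of informed
nodes among the others. -/
lemma le_mean_notMem_ignorant (mode : CallMode) (rule : PacketRule)
    (φ : Module.Dual (ZMod 2) (Fin k → ZMod 2)) (Y : GossipState V (ZMod 2) k) {v : V}
    (hv : v ∈ ignorant φ Y) :
    (((ignorant φ Y)ᶜ.card : ℕ) : ℝ) / (4 * (Fintype.card V - 1)) ≤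
      mean fun ω : RoundChoice Y =>
        ind (v ∉ ignorant φ (nextState mode rule Y ω)) := by
  have hn := one_le_card_sub_one V
  have hI : v ∉ (ignorant φ Y)ᶜ := by simpa using hv
  have hgood : ∀ s ∈ (ignorant φ Y)ᶜ, mean (fun p : ∀ l : V × V, Y l.1 =>
      ind (φ (sentPacket rule p s v) ≠ 0)) = 1 / 2 := fun s hs =>
    mean_sentPacket_ne_zero rule v (by simpa using hs)
  by_cases hmode : mode = .pull
  · subst hmode
    have h1 : ∀ p : ∀ l : V × V, Y l.1, (1 / ((Fintype.card V : ℝ) - 1)) *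
        (∑ s ∈ (ignorant φ Y)ᶜ, ind (φ (sentPacket rule p s v) ≠ 0))
        ≤ mean fun c : ∀ u : V, {w : V // w ≠ u} =>
          ind (v ∉ ignorant φ (nextState .pull rule Y (c, p))) := by
      intro p
      have hG : v ∉ (ignorant φ Y)ᶜ.filter (fun s => φ (sentPacket rule p s v) ≠ 0) :=
        fun h => hI (Finset.mem_filter.1 h).1
      refine le_trans (le_of_eq ?_) ((mean_call_mem hG).ge.trans (mean_mono fun c =>
        ind_mono ?_))
      · rw [sum_ind, one_div_mul_eq_div]
      · intro hc
        exact notMem_ignorant_nextState (u := (c v : V)) (mode := .pull) rfl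
          (Finset.mem_filter.1 hc).2
    rw [mean_prod, mean_comm]
    refine le_trans ?_ (mean_mono h1)
    rw [mean_const_mul, mean_sum, Finset.sum_congr rfl hgood, Finset.sum_const, nsmul_eq_mul,
      mul_one_div, one_div_mul_eq_div, div_div]
    gcongr
    linarith
  · refine (le_mean_exists_good_call Y hI (fun p s => φ (sentPacket rule p s v) ≠ 0) hgood).trans
      (mean_mono fun ω => ind_mono ?_)
    rintro ⟨s, _, hg, hc⟩
    refine notMem_ignorant_nextState (u := s) ?_ hg
    cases mode
    · exact hc
    · exact absurd rfl hmode
    · exact Or.inl hc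

open Classical in
/-- In each round the number of informed nodes grows, in expectation, by at least the stated
amount, even when the growth is truncated at a factor of two. For the push model this counts the
informed nodes that inform somebody, for the pull model the informed nodes that get pulled. -/
lemma exists_truncated_growth (mode : CallMode) (rule : PacketRule)
    (φ : Module.Dual (ZMod 2) (Fin k → ZMod 2)) (Y : GossipState V (ZMod 2) k) :
    ∃ X : RoundChoice Y → ℝ,
      (∀ ω, 0 ≤ X ω ∧ X ω ≤ (ignorant φ Y)ᶜ.card ∧
        (ignorant φ Y)ᶜ.card + X ω ≤ (ignorant φ (nextState mode rule Y ω))ᶜ.card) ∧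
      ((ignorant φ Y)ᶜ.card : ℝ) * (ignorant φ Y).card / (4 * (Fintype.card V - 1)) ≤ mean X := by
  set U := ignorant φ Y with hU
  have hsub : ∀ ω : RoundChoice Y, ∀ N : Finset V,
      (∀ v ∈ N, v ∈ U ∧ v ∉ ignorant φ (nextState mode rule Y ω)) →
      Uᶜ.card + N.card ≤ (ignorant φ (nextState mode rule Y ω))ᶜ.card := by
    intro ω N hN
    rw [← Finset.card_union_of_disjoint]
    · refine Finset.card_le_card (Finset.union_subset ?_ ?_)
      · exact Finset.compl_subset_compl.2 (ignorant_anti (le_nextState mode rule Y ω))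
      · intro v hv
        exact Finset.mem_compl.2 (hN v hv).2
    · rw [Finset.disjoint_left]
      intro v hv hv'
      exact (Finset.mem_compl.1 hv) (hN v hv').1
  by_cases hmode : mode = .pull
  · subst hmode
    let X : RoundChoice Y → Finset V := fun ω => Uᶜ.filter fun u =>
      ∃ v ∈ U, φ (sentPacket rule ω.2 u v) ≠ 0 ∧ (ω.1 v : V) = u
    refine ⟨fun ω => (X ω).card, fun ω => ⟨Nat.cast_nonneg _,
      Nat.cast_le.2 (Finset.card_filter_le _ _), ?_⟩, ?_⟩
    · let N : Finset V := U.filter fun v => φ (sentPacket rule ω.2 (ω.1 v) v) ≠ 0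
      have h1 : (X ω).card ≤ N.card := by
        refine (Finset.card_le_card (t := N.image fun v => (ω.1 v : V)) ?_).trans
          Finset.card_image_le
        intro u hu
        obtain ⟨v, hv, hg, hc⟩ := (Finset.mem_filter.1 hu).2
        refine Finset.mem_image.2 ⟨v, Finset.mem_filter.2 ⟨hv, ?_⟩, hc⟩
        rw [hc]
        exact hg
      have h2 := hsub ω N (by
        intro v hv
        obtain ⟨hv, hg⟩ := Finset.mem_filter.1 hv
        exact ⟨hv, notMem_ignorant_nextState (u := (ω.1 v : V)) (mode := .pull) rfl hg⟩)
      have h3 := (Nat.add_le_add_left h1 _).trans h2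
      beta_reduce
      exact_mod_cast h3
    · have h1 : (fun ω => ((X ω).card : ℝ)) = fun ω => ∑ u ∈ Uᶜ,
          ind (∃ v ∈ U, φ (sentPacket rule ω.2 u v) ≠ 0 ∧ (ω.1 v : V) = u) := by
        funext ω
        rw [sum_ind]
      rw [h1, mean_sum, mul_div_assoc, ← nsmul_eq_mul, ← Finset.sum_const]
      refine Finset.sum_le_sum fun u hu => ?_
      have hu' := Finset.mem_compl.1 hu
      exact le_mean_exists_good_call Y hu' (fun p v => φ (sentPacket rule p u v) ≠ 0)
        (fun v _ => mean_sentPacket_ne_zero rule v hu')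
  · let X : RoundChoice Y → Finset V := fun ω => U.filter fun v =>
      ∃ u ∈ Uᶜ, φ (sentPacket rule ω.2 u v) ≠ 0 ∧ (ω.1 u : V) = v
    refine ⟨fun ω => (X ω).card, fun ω => ⟨Nat.cast_nonneg _, ?_, ?_⟩, ?_⟩
    · have h1 : (X ω).card ≤ Uᶜ.card := by
        refine (Finset.card_le_card (t := Uᶜ.image fun v => (ω.1 v : V)) ?_).trans
          Finset.card_image_le
        intro v hv
        obtain ⟨u, hu, _, hc⟩ := (Finset.mem_filter.1 hv).2
        exact Finset.mem_image.2 ⟨u, hu, hc⟩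
      exact Nat.cast_le.2 h1
    · have h2 := hsub ω (X ω) (by
        intro v hv
        obtain ⟨hv, u, hu, hg, hc⟩ := Finset.mem_filter.1 hv
        refine ⟨hv, notMem_ignorant_nextState (u := u) ?_ hg⟩
        cases mode
        · exact hc
        · exact absurd rfl hmode
        · exact Or.inl hc)
      beta_reduce
      exact_mod_cast h2
    · have h1 : (fun ω => ((X ω).card : ℝ)) = fun ω => ∑ v ∈ U,
          ind (∃ u ∈ Uᶜ, φ (sentPacket rule ω.2 u v) ≠ 0 ∧ (ω.1 u : V) = v) := by
        funext ω
        rw [sum_ind]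
      rw [h1, mean_sum, mul_comm, mul_div_assoc, ← nsmul_eq_mul, ← Finset.sum_const]
      refine Finset.sum_le_sum fun v hv => ?_
      exact le_mean_exists_good_call Y (by simpa using hv)
        (fun p u => φ (sentPacket rule p u v) ≠ 0)
        (fun u hu => mean_sentPacket_ne_zero rule v (by simpa using hu))

open Classical in
/-- The ratio of the numbers of ignorant and of informed nodes, the potential of the upper bound. -/
noncomputable def ignoranceRatio (φ : Module.Dual (ZMod 2) (Fin k → ZMod 2))
    (Y : GossipState V (ZMod 2) k) : ℝ :=
  (ignorant φ Y).card / (ignorant φ Y)ᶜ.card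

/-- The ignorance ratio decreases in expectation by a constant factor in every round. -/
lemma stepMean_ignoranceRatio_le (mode : CallMode) (rule : PacketRule)
    (φ : Module.Dual (ZMod 2) (Fin k → ZMod 2)) (Y : GossipState V (ZMod 2) k)
    (hY : ∃ v, v ∉ ignorant φ Y) :
    stepMean mode rule (ignoranceRatio φ) Y ≤ 15 / 16 * ignoranceRatio φ Y := by
  classical
  have hN := one_le_card_sub_one V
  set n : ℝ := (Fintype.card V : ℝ) with hn
  have hcard : ∀ Z : GossipState V (ZMod 2) k,
      ((ignorant φ Z).card : ℝ) + ((ignorant φ Z)ᶜ.card : ℕ) = n := by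
    intro Z
    rw [hn]
    exact_mod_cast Finset.card_add_card_compl (ignorant φ Z)
  have hm : (1 : ℝ) ≤ ((ignorant φ Y)ᶜ.card : ℕ) := by
    obtain ⟨v, hv⟩ := hY
    exact_mod_cast Finset.card_pos.2 ⟨v, Finset.mem_compl.2 hv⟩
  have hmono : ∀ ω : RoundChoice Y, ((ignorant φ Y)ᶜ.card : ℝ) ≤
      ((ignorant φ (nextState mode rule Y ω))ᶜ.card : ℕ) := by
    intro ω
    exact_mod_cast Finset.card_le_card
      (Finset.compl_subset_compl.2 (ignorant_anti (le_nextState mode rule Y ω)))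
  have hY' := hcard Y
  set m : ℝ := ((ignorant φ Y)ᶜ.card : ℝ) with hmdef
  unfold stepMean
  simp only [ignoranceRatio, ← hmdef]
  have hm0 : 0 < m := by linarith
  rcases le_total m (ignorant φ Y).card with hle | hle
  · -- few informed nodes: `|U'| / |I'| = n / |I'| - 1`, and `1 / |I'|` shrinks on average
    obtain ⟨X, hX, hXm⟩ := exists_truncated_growth mode rule φ Y
    rw [← hmdef, ← hn] at hXm
    have hpt : ∀ ω : RoundChoice Y,
        ((ignorant φ (nextState mode rule Y ω)).card : ℝ) /
          ((ignorant φ (nextState mode rule Y ω))ᶜ.card : ℕ) ≤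
        (n / m - 1) - n / (2 * m ^ 2) * X ω := by
      intro ω
      obtain ⟨h0, h1, h2⟩ := hX ω
      rw [← hmdef] at h1 h2
      have h3 := hcard (nextState mode rule Y ω)
      set m' : ℝ := ((ignorant φ (nextState mode rule Y ω))ᶜ.card : ℝ)
      have hm' : 0 < m' := by linarith
      have h4 : 1 / m' ≤ 1 / m - 1 / (2 * m ^ 2) * X ω := by
        have h5 : 1 / m' ≤ 1 / (m + X ω) := one_div_le_one_div_of_le (by linarith) h2
        refine h5.trans ?_
        rw [div_le_iff₀ (by linarith)]
        have h6 : (1 / m - 1 / (2 * m ^ 2) * X ω) * (m + X ω) =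
            1 + X ω * (m - X ω) / (2 * m ^ 2) := by
          field_simp
          ring
        rw [h6]
        have : 0 ≤ X ω * (m - X ω) / (2 * m ^ 2) :=
          div_nonneg (mul_nonneg h0 (by linarith)) (by positivity)
        linarith
      have h7 : ((ignorant φ (nextState mode rule Y ω)).card : ℝ) / m' = n * (1 / m') - 1 := by
        rw [← h3]
        field_simp
        ring
      rw [h7]
      calc n * (1 / m') - 1 ≤ n * (1 / m - 1 / (2 * m ^ 2) * X ω) - 1 := by gcongr
        _ = _ := by ring
    refine (mean_mono hpt).trans ?_
    rw [mean_sub, mean_const, mean_const_mul]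
    have h8 : m / 8 ≤ mean X := by
      refine le_trans ?_ hXm
      rw [div_le_div_iff₀ (by norm_num) (by linarith)]
      nlinarith
    have h9 : n / (2 * m ^ 2) * (m / 8) ≤ n / (2 * m ^ 2) * mean X :=
      mul_le_mul_of_nonneg_left h8 (by positivity)
    have h10 : n / (2 * m ^ 2) * (m / 8) = n / m / 16 := by
      field_simp
      ring
    have h11 : ((ignorant φ Y).card : ℝ) / m = n / m - 1 := by
      rw [← hY']
      field_simp
      ring
    rw [h11]
    linarith
  · -- many informed nodes: each ignorant node is informed with constant probability
    have hpt : ∀ ω : RoundChoice Y,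
        ((ignorant φ (nextState mode rule Y ω)).card : ℝ) /
          ((ignorant φ (nextState mode rule Y ω))ᶜ.card : ℕ) ≤
        1 / m * ∑ v ∈ ignorant φ Y,
          (1 - ind (v ∉ ignorant φ (nextState mode rule Y ω))) := by
      intro ω
      have h1 : (ignorant φ (nextState mode rule Y ω)).card =
          ∑ v ∈ ignorant φ Y,
            (1 - ind (v ∉ ignorant φ (nextState mode rule Y ω))) := by
        have h2 : ∀ v ∈ ignorant φ Y,
            (1 - ind (v ∉ ignorant φ (nextState mode rule Y ω))) =
            ind (v ∈ ignorant φ (nextState mode rule Y ω)) := by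
          intro v _
          rw [← ind_not, not_not]
        rw [Finset.sum_congr rfl h2, sum_ind, Finset.filter_mem_eq_inter,
          Finset.inter_eq_right.2 (ignorant_anti (le_nextState mode rule Y ω))]
      rw [← h1, one_div_mul_eq_div]
      gcongr
      exact hmono ω
    refine (mean_mono hpt).trans ?_
    rw [mean_const_mul, mean_sum, one_div_mul_eq_div, mul_div_assoc']
    gcongr
    have h3 : ∀ v ∈ ignorant φ Y, mean (fun ω : RoundChoice Y =>
        (1 - ind (v ∉ ignorant φ (nextState mode rule Y ω)))) ≤ 15 / 16 := by
      intro v hv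
      rw [mean_sub, mean_const]
      have h4 := le_mean_notMem_ignorant mode rule φ Y hv
      rw [← hmdef, ← hn] at h4
      have h5 : 1 / 16 ≤ m / (4 * (n - 1)) := by
        rw [div_le_div_iff₀ (by norm_num) (by linarith)]
        linarith
      linarith
    refine (Finset.sum_le_sum h3).trans (le_of_eq ?_)
    rw [Finset.sum_const, nsmul_eq_mul]
    ring

instance dual_finite : Finite (Module.Dual (ZMod 2) (Fin k → ZMod 2)) :=
  Finite.of_injective _ DFunLike.coe_injective

lemma card_dual : Nat.card (Module.Dual (ZMod 2) (Fin k → ZMod 2)) = 2 ^ k := by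
  have := Fintype.ofFinite (Module.Dual (ZMod 2) (Fin k → ZMod 2))
  rw [Nat.card_eq_fintype_card, Module.card_eq_pow_finrank (K := ZMod 2),
    Subspace.dual_finrank_eq, Module.finrank_fin_fun, ZMod.card]

/-- A union bound over all functionals of the geometric decay of their ignorance ratios. -/
lemma one_sub_spreadProb_le (mode : CallMode) (rule : PacketRule) (A : V → Set (Fin k))
    (hA : ∀ i, ∃ v, i ∈ A v) (t : ℕ) :
    1 - spreadProb (ZMod 2) mode rule A t ≤
      2 ^ k * (Fintype.card V : ℝ) ^ 2 * (15 / 16) ^ t := by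
  classical
  have := Fintype.ofFinite (Module.Dual (ZMod 2) (Fin k → ZMod 2))
  set n : ℝ := (Fintype.card V : ℝ) with hn
  have hN := one_le_card_sub_one V
  let D : Finset (Module.Dual (ZMod 2) (Fin k → ZMod 2)) := Finset.univ.filter (· ≠ 0)
  let P : GossipState V (ZMod 2) k → Prop := fun Y => ∀ φ ∈ D, ∃ v, v ∉ ignorant φ Y
  have hle : ∀ φ (Y : GossipState V (ZMod 2) k),
      ((ignorant φ Y).card : ℝ) ≤ n ∧ (((ignorant φ Y)ᶜ.card : ℕ) : ℝ) ≤ n := by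
    intro φ Y
    exact ⟨Nat.cast_le.2 (Finset.card_le_univ _), Nat.cast_le.2 (Finset.card_le_univ _)⟩
  have hpos : ∀ Y, P Y → ∀ φ ∈ D, (1 : ℝ) ≤ ((ignorant φ Y)ᶜ.card : ℕ) := by
    intro Y hY φ hφ
    obtain ⟨v, hv⟩ := hY φ hφ
    exact_mod_cast Finset.card_pos.2 ⟨v, Finset.mem_compl.2 hv⟩
  have hratio : ∀ φ (Y : GossipState V (ZMod 2) k), 0 ≤ ignoranceRatio φ Y := fun φ Y => by
    unfold ignoranceRatio
    positivity
  have hP0 : P (initialState (ZMod 2) A) := by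
    intro φ hφ
    by_contra hcon
    push Not at hcon
    refine (Finset.mem_filter.1 hφ).2 (LinearMap.pi_ext' fun i => LinearMap.ext_ring ?_)
    obtain ⟨v, hv⟩ := hA i
    exact mem_ignorant.1 (hcon v) (Submodule.subset_span ⟨i, hv, rfl⟩)
  rw [spreadProb_eq_iterate]
  have h1 := congrFun (iterate_stepMean_one_sub mode rule
    (fun Y : GossipState V (ZMod 2) k => ind (∀ v, Y v = ⊤)) t)
    (initialState (ZMod 2) A)
  rw [← h1]
  refine (iterate_stepMean_le mode rule P ?_ _
    (fun s Y => (15 / 16) ^ s * ∑ φ ∈ D, n * ignoranceRatio φ Y) ?_ ?_ t _ hP0).trans ?_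
  · intro Y ω hY φ hφ
    obtain ⟨v, hv⟩ := hY φ hφ
    exact ⟨v, fun h => hv (ignorant_anti (le_nextState mode rule Y ω) h)⟩
  · intro Y hY
    have h0 : ∀ φ ∈ D, 0 ≤ n * ignoranceRatio φ Y := fun φ _ =>
      mul_nonneg (by linarith) (hratio φ Y)
    by_cases hfull : ∀ v, Y v = ⊤
    · rw [ind_of_true hfull, sub_self, pow_zero, one_mul]
      exact Finset.sum_nonneg h0
    · rw [ind_of_false hfull, sub_zero, pow_zero, one_mul]
      push Not at hfull
      obtain ⟨v, hv⟩ := hfull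
      obtain ⟨φ, hφ0, hφ⟩ := Submodule.exists_le_ker_of_lt_top _ (lt_top_iff_ne_top.2 hv)
      have hφD : φ ∈ D := Finset.mem_filter.2 ⟨Finset.mem_univ _, hφ0⟩
      refine le_trans ?_ (Finset.single_le_sum h0 hφD)
      have hm := hpos Y hY φ hφD
      have hu : (1 : ℝ) ≤ (ignorant φ Y).card := by
        exact_mod_cast Finset.card_pos.2 ⟨v, mem_ignorant.2 hφ⟩
      rw [ignoranceRatio, mul_div_assoc', le_div_iff₀ (by linarith)]
      nlinarith [(hle φ Y).2]
  · intro s Y hY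
    rw [stepMean, mean_const_mul, mean_sum, pow_succ, mul_assoc]
    refine mul_le_mul_of_nonneg_left ?_ (by positivity)
    rw [Finset.mul_sum]
    refine Finset.sum_le_sum fun φ hφ => ?_
    rw [mean_const_mul]
    calc n * mean (fun ω : RoundChoice Y => ignoranceRatio φ (nextState mode rule Y ω))
        ≤ n * (15 / 16 * ignoranceRatio φ Y) := by
          gcongr
          exact stepMean_ignoranceRatio_le mode rule φ Y (hY φ hφ)
      _ = _ := by ring
  · rw [mul_comm]
    gcongr
    have h2 : ∀ φ ∈ D, n * ignoranceRatio φ (initialState (ZMod 2) A) ≤ n ^ 2 := by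
      intro φ hφ
      rw [sq]
      gcongr
      have hm := hpos _ hP0 φ hφ
      rw [ignoranceRatio, div_le_iff₀ (by linarith)]
      nlinarith [(hle φ (initialState (ZMod 2) A)).1]
    refine (Finset.sum_le_sum h2).trans ?_
    rw [Finset.sum_const, nsmul_eq_mul]
    gcongr
    have h3 : D.card ≤ 2 ^ k := by
      rw [← card_dual, Nat.card_eq_fintype_card]
      exact Finset.card_le_univ _
    exact_mod_cast h3

lemma exists_upper_bound (mode : CallMode) (rule : PacketRule) (a : ℝ) (ha : 0 < a) :
    ∃ C : ℝ, 0 < C ∧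
      ∀ (V : Type) [Fintype V] [Nontrivial V] (k : ℕ) (A : V → Set (Fin k)),
        (∀ i, ∃ v, i ∈ A v) →
        ∀ t : ℕ, C * ((k : ℝ) + Real.log (Fintype.card V)) ≤ (t : ℝ) →
          1 - (Fintype.card V : ℝ) ^ (-a) ≤ spreadProb (ZMod 2) mode rule A t := by
  have hl : 0 < Real.log (16 / 15) := Real.log_pos (by norm_num)
  refine ⟨(2 + a) / Real.log (16 / 15), by positivity, ?_⟩
  intro V _ _ k A hA t ht
  have h := one_sub_spreadProb_le mode rule A hA t
  have hN := one_le_card_sub_one V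
  set n : ℝ := (Fintype.card V : ℝ)
  have hn : 0 < n := by linarith
  have hlog : 0 ≤ Real.log n := Real.log_nonneg (by linarith)
  have h2 : (2 : ℝ) ^ k * n ^ 2 * (15 / 16) ^ t ≤ n ^ (-a) := by
    rw [Real.rpow_def_of_pos hn]
    have e1 : (2 : ℝ) ^ k = Real.exp (k * Real.log 2) := by
      rw [Real.exp_nat_mul, Real.exp_log (by norm_num)]
    have e2 : n ^ 2 = Real.exp (2 * Real.log n) := by
      have := Real.exp_nat_mul (Real.log n) 2
      rw [Real.exp_log hn] at this
      exact_mod_cast this.symm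
    have e3 : (15 / 16 : ℝ) ^ t = Real.exp (-(t * Real.log (16 / 15))) := by
      rw [Real.exp_neg, Real.exp_nat_mul, Real.exp_log (by norm_num), ← inv_pow]
      norm_num
    rw [e1, e2, e3, ← Real.exp_add, ← Real.exp_add, Real.exp_le_exp]
    have h3 : (2 + a) * ((k : ℝ) + Real.log n) ≤ t * Real.log (16 / 15) := by
      rw [div_mul_eq_mul_div, div_le_iff₀ hl] at ht
      exact ht
    have h4 : (k : ℝ) * Real.log 2 ≤ k :=
      mul_le_of_le_one_right (by positivity)
        (by linarith [Real.log_le_sub_one_of_pos (x := 2) (by norm_num)])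
    have h5 : (0 : ℝ) ≤ k := by positivity
    nlinarith
  linarith

end Upper

/-! ### The lower bound in terms of the number of messages -/

lemma Transmits.call {V : Type} {mode : CallMode} {c : ∀ u : V, {v : V // v ≠ u}} {u v : V}
    (h : Transmits mode c u v) : (c u : V) = v ∨ (c v : V) = u := by
  cases mode
  · exact Or.inl h
  · exact Or.inr h
  · exact h

lemma finrank_initialState_le {V : Type} {k : ℕ} (A : V → Set (Fin k)) (v : V) :
    (Module.finrank (ZMod 2) (initialState (ZMod 2) A v) : ℝ) + ({i | i ∉ A v}.ncard : ℝ) ≤ k := by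
  classical
  have h1 : initialState (ZMod 2) A v = Submodule.span (ZMod 2)
      ((Finset.univ.filter (· ∈ A v)).image fun i => (Pi.single i 1 : Fin k → ZMod 2)) := by
    rw [initialState]
    congr 1
    ext x
    simp [eq_comm]
  have h2 := (finrank_span_finset_le_card (R := ZMod 2) ((Finset.univ.filter (· ∈ A v)).image
    fun i => (Pi.single i 1 : Fin k → ZMod 2))).trans Finset.card_image_le
  have h3 : {i | i ∉ A v}.ncard = (Finset.univ.filter (· ∉ A v)).card := by
    rw [← Set.ncard_coe_finset]
    simp
  have h4 := Finset.card_filter_add_card_filter_not (s := Finset.univ) (· ∈ A v)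
  rw [Finset.card_univ, Fintype.card_fin] at h4
  rw [h1, h3]
  have h5 := (Nat.add_le_add_right h2 _).trans h4.le
  exact_mod_cast h5

lemma finrank_nextState_le {V : Type} [Fintype V] {k : ℕ} (mode : CallMode)
    (rule : PacketRule) (Y : GossipState V (ZMod 2) k) (ω : RoundChoice Y) (v : V) :
    (Module.finrank (ZMod 2) (nextState mode rule Y ω v) : ℝ) ≤
      Module.finrank (ZMod 2) (Y v) + 1 + ∑ u, ind ((ω.1 u : V) = v) := by
  classical
  rw [sum_ind]
  let R : Finset V := insert (ω.1 v : V) (Finset.univ.filter fun u => (ω.1 u : V) = v)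
  have h1 : nextState mode rule Y ω v ≤
      Y v ⊔ Submodule.span (ZMod 2) (R.image fun u => sentPacket rule ω.2 u v) := by
    refine sup_le_sup_left (Submodule.span_mono ?_) _
    rintro x ⟨u, hu, rfl⟩
    refine Finset.mem_coe.2 (Finset.mem_image_of_mem _ (Finset.mem_insert.2 ?_))
    exact hu.call.symm.imp Eq.symm fun h => Finset.mem_filter.2 ⟨Finset.mem_univ _, h⟩
  have h2 := (Submodule.finrank_mono h1).trans (Submodule.finrank_add_le_finrank_add_finrank _ _)
  have h3 := (finrank_span_finset_le_card (R := ZMod 2)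
    (R.image fun u => sentPacket rule ω.2 u v)).trans Finset.card_image_le
  have h4 : R.card ≤ _ + 1 := Finset.card_insert_le _ _
  have h5 := h2.trans (Nat.add_le_add_left (h3.trans h4) _)
  have h6 : (Module.finrank (ZMod 2) (nextState mode rule Y ω v) : ℝ) ≤ _ := Nat.cast_le.2 h5
  push_cast at h6
  linarith

section Dimension

variable {V : Type} [Fintype V] [Nontrivial V] {k : ℕ}

/-- Exponential moment of the number of calls that a node receives in one round. -/
lemma mean_exp_calls_le (v : V) {b : ℝ} (hb : 0 ≤ b) :
    mean (fun c : ∀ u : V, {w : V // w ≠ u} => Real.exp (b * ∑ u, ind ((c u : V) = v))) ≤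
      Real.exp (Real.exp b) := by
  classical
  have hN := one_le_card_sub_one V
  have h1 : (fun c : ∀ u : V, {w : V // w ≠ u} => Real.exp (b * ∑ u, ind ((c u : V) = v))) =
      fun c => ∏ u, Real.exp (b * ind ((c u : V) = v)) := by
    funext c
    rw [Finset.mul_sum, Real.exp_sum]
  have he : 1 ≤ Real.exp b := Real.one_le_exp hb
  have h2 : ∀ u, mean (fun w : {w : V // w ≠ u} => Real.exp (b * ind ((w : V) = v))) ≤
      Real.exp ((Real.exp b - 1) / (Fintype.card V - 1) * ind (u ≠ v)) := by
    intro u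
    by_cases huv : u = v
    · have h3 : (fun w : {w : V // w ≠ u} => Real.exp (b * ind ((w : V) = v))) = fun _ => 1 := by
        funext w
        rw [ind_of_false (fun h => w.2 (h.trans huv.symm)), mul_zero, Real.exp_zero]
      rw [h3, mean_const]
      exact Real.one_le_exp (mul_nonneg (div_nonneg (by linarith) (by linarith)) (ind_nonneg _))
    · have h3 : (fun w : {w : V // w ≠ u} => Real.exp (b * ind ((w : V) = v))) =
          fun w : {w : V // w ≠ u} => if (w : V) = v then Real.exp b else 1 := by
        funext w
        by_cases h : (w : V) = v
        · rw [if_pos h, ind_of_true h, mul_one]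
        · rw [if_neg h, ind_of_false h, mul_zero, Real.exp_zero]
      have h4 := mean_callTarget_eq huv (Real.exp b)
      rw [h3, ind_of_true huv, mul_one]
      refine le_trans (le_of_eq ?_)
        (Real.add_one_le_exp ((Real.exp b - 1) / ((Fintype.card V : ℝ) - 1)))
      rw [add_comm _ (1 : ℝ), ← h4]
  rw [h1, mean_pi_prod (β := fun u => {w : V // w ≠ u})
    (fun u w => Real.exp (b * ind ((w : V) = v)))]
  refine (Finset.prod_le_prod (fun u _ => mean_nonneg fun _ => (Real.exp_pos _).le)
    fun u _ => h2 u).trans ?_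
  rw [← Real.exp_sum, Real.exp_le_exp, ← Finset.mul_sum, sum_ind, Finset.filter_ne',
    Finset.card_erase_of_mem (Finset.mem_univ v), Finset.card_univ,
    Nat.cast_sub Fintype.card_pos, Nat.cast_one, div_mul_cancel₀ _ (by linarith)]
  linarith

lemma stepMean_exp_finrank_le (mode : CallMode) (rule : PacketRule) (v : V) {b : ℝ} (hb : 0 ≤ b)
    (r : ℝ) (Y : GossipState V (ZMod 2) k) :
    stepMean mode rule (fun Z => Real.exp (b * Module.finrank (ZMod 2) (Z v) + r)) Y ≤
      Real.exp (b * Module.finrank (ZMod 2) (Y v) + (r + (b + Real.exp b))) := by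
  have h1 : ∀ ω : RoundChoice Y,
      Real.exp (b * Module.finrank (ZMod 2) (nextState mode rule Y ω v) + r) ≤
      Real.exp (b * Module.finrank (ZMod 2) (Y v) + r + b) *
        Real.exp (b * ∑ u, ind ((ω.1 u : V) = v)) := by
    intro ω
    rw [← Real.exp_add, Real.exp_le_exp]
    have := mul_le_mul_of_nonneg_left (finrank_nextState_le mode rule Y ω v) hb
    linarith
  refine (mean_mono h1).trans ?_
  rw [mean_const_mul, mean_prod]
  simp only [mean_const]
  refine (mul_le_mul_of_nonneg_left (mean_exp_calls_le v hb) (Real.exp_pos _).le).trans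
    (le_of_eq ?_)
  rw [← Real.exp_add]
  congr 1
  ring

/-- A node can decode only if it has received as many packets as it misses messages. -/
lemma spreadProb_le_exp_finrank (mode : CallMode) (rule : PacketRule) (A : V → Set (Fin k)) (v : V)
    {b : ℝ} (hb : 0 ≤ b) (t : ℕ) :
    spreadProb (ZMod 2) mode rule A t ≤
      Real.exp (-(b * ({i | i ∉ A v}.ncard : ℝ)) + t * (b + Real.exp b)) := by
  rw [spreadProb_eq_iterate]
  refine (iterate_stepMean_le mode rule (fun _ => True) (fun _ _ _ => trivial) _
    (fun s Y => Real.exp (b * Module.finrank (ZMod 2) (Y v) + (-(b * k) + s * (b + Real.exp b))))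
    ?_ ?_ t _ trivial).trans ?_
  · intro Y _
    by_cases h : ∀ v, Y v = ⊤
    · rw [ind_of_true h, h v, finrank_top, Module.finrank_fin_fun]
      simp
    · rw [ind_of_false h]
      positivity
  · intro s Y _
    refine (stepMean_exp_finrank_le mode rule v hb _ Y).trans (le_of_eq ?_)
    push_cast
    congr 1
    ring
  · rw [Real.exp_le_exp]
    have := mul_le_mul_of_nonneg_left (finrank_initialState_le A v) hb
    linarith

end Dimension

/-! ### The lower bound in terms of the number of nodes -/

lemma exp_neg_le_one_sub_half {y : ℝ} (h0 : 0 ≤ y) (h1 : y ≤ 1 / 2) :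
    Real.exp (-y) ≤ 1 - y / 2 := by
  have h := Real.abs_exp_sub_one_sub_id_le (x := -y) (by rw [abs_neg, abs_of_nonneg h0]; linarith)
  have := (abs_le.1 h).2
  nlinarith

lemma exp_le_one_add_two_mul {y : ℝ} (h0 : 0 ≤ y) (h1 : y ≤ 1) : Real.exp y ≤ 1 + 2 * y := by
  have h := Real.abs_exp_sub_one_sub_id_le (x := y) (by rwa [abs_of_nonneg h0])
  have := (abs_le.1 h).2
  nlinarith

/-- Laplace transform of a Bernoulli variable. -/
lemma mean_exp_neg_ind_le {α : Type*} [Finite α] [Nonempty α] (P : α → Prop) {y : ℝ} (h0 : 0 ≤ y)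
    (h1 : y ≤ 1 / 2) :
    mean (fun x => Real.exp (-(y * ind (P x)))) ≤ Real.exp (-(y * (mean fun x => ind (P x)) / 2)) := by
  have h : (fun x => Real.exp (-(y * ind (P x)))) =
      fun x => 1 - (1 - Real.exp (-y)) * ind (P x) := by
    funext x
    by_cases hx : P x
    · rw [ind_of_true hx, mul_one]
      ring
    · rw [ind_of_false hx, mul_zero, neg_zero, Real.exp_zero]
      ring
  rw [h, mean_sub, mean_const, mean_const_mul]
  have h2 := exp_neg_le_one_sub_half h0 h1
  have h3 : 0 ≤ mean fun x => ind (P x) := mean_nonneg fun x => ind_nonneg _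
  have h4 := Real.add_one_le_exp (-(y * (mean fun x => ind (P x)) / 2))
  nlinarith

lemma half_le_mean_eq_zero {M : Type*} [AddCommGroup M] [Module (ZMod 2) M]
    (S : Submodule (ZMod 2) M) [Finite S] (φ : Module.Dual (ZMod 2) M) :
    1 / 2 ≤ mean (fun x : S => ind (φ x = 0)) := by
  by_cases h : S ≤ LinearMap.ker φ
  · have h1 : (fun x : S => ind (φ x = 0)) = fun _ => 1 := by
      funext x
      exact ind_of_true (h x.2)
    rw [h1, mean_const]
    norm_num
  · have h1 := mean_ne_zero S φ h
    simp only [ne_eq, ind_not] at h1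
    rw [mean_sub, mean_const] at h1
    linarith

lemma sum_ind_eq_mul {α : Type*} [Fintype α] (x : α) (h : α → ℝ) :
    ∑ l, ind (x = l) * h l = h x := by
  rw [Finset.sum_eq_single_of_mem x (Finset.mem_univ x), ind_of_true rfl, one_mul]
  intro b _ hb
  rw [ind_of_false hb.symm, zero_mul]

/-- The link whose packet is used for the transmission from `l.1` to `l.2`. -/
def packetLink {V : Type} (rule : PacketRule) (l : V × V) : V × V :=
  match rule with
  | .perNode => (l.1, l.1)
  | .perLink => l

lemma packetLink_fst {V : Type} (rule : PacketRule) (l : V × V) : (packetLink rule l).1 = l.1 := by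
  cases rule <;> rfl

section Survival

variable {V : Type} [Fintype V] {k : ℕ}

lemma exp_neg_nine_le_pow (hV : (8 : ℝ) ≤ Fintype.card V - 1) :
    Real.exp (-9) ≤ (1 - 4 / ((Fintype.card V : ℝ) - 1)) ^ Fintype.card V := by
  set N : ℝ := (Fintype.card V : ℝ) - 1 with hN
  have hx : 4 / N ≤ 1 / 2 := by
    rw [div_le_div_iff₀ (by linarith) (by norm_num)]
    linarith
  have hx0 : 0 ≤ 4 / N := div_nonneg (by norm_num) (by linarith)
  -- `exp (-2 x) ≤ 1 - x` for `0 ≤ x ≤ 1 / 2`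
  have h1 : Real.exp (-(2 * (4 / N))) ≤ 1 - 4 / N := by
    rw [Real.exp_neg]
    refine inv_le_of_inv_le₀ (by linarith) ?_
    rw [inv_le_iff_one_le_mul₀ (by linarith)]
    have h2 := Real.add_one_le_exp (2 * (4 / N))
    nlinarith
  calc Real.exp (-9) ≤ Real.exp (Fintype.card V * -(2 * (4 / N))) := by
        rw [Real.exp_le_exp]
        have h3 : (Fintype.card V : ℝ) = N + 1 := by rw [hN]; ring
        have h4 : (N + 1) * -(2 * (4 / N)) = -8 - 2 * (4 / N) := by
          have : N ≠ 0 := by linarith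
          field_simp
          ring
        rw [h3, h4]
        linarith
    _ = Real.exp (-(2 * (4 / N))) ^ Fintype.card V := Real.exp_nat_mul _ _
    _ ≤ _ := pow_le_pow_left₀ (Real.exp_pos _).le h1 _

/-- Exponential concentration of a weighted number of packets annihilated by `φ`: they are independent,
and each one is annihilated with probability at least one half. -/
lemma mean_exp_packets_le (φ : Module.Dual (ZMod 2) (Fin k → ZMod 2)) (Y : GossipState V (ZMod 2) k)
    (β : V × V → ℝ) (h0 : ∀ l, 0 ≤ β l) (h1 : ∀ l, β l ≤ 1) {y : ℝ} (hy0 : 0 ≤ y)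
    (hy1 : y ≤ 1 / 2) :
    mean (fun p : ∀ l : V × V, Y l.1 =>
      Real.exp (-(y * ∑ l, β l * ind (φ (p l) = 0)))) ≤ Real.exp (-(y / 4 * ∑ l, β l)) := by
  have e1 : (fun p : ∀ l : V × V, Y l.1 => Real.exp (-(y * ∑ l, β l * ind (φ (p l) = 0)))) =
      fun p => ∏ l, Real.exp (-(y * β l * ind (φ (p l) = 0))) := by
    funext p
    rw [← Real.exp_sum, Finset.sum_neg_distrib, Finset.mul_sum]
    simp only [mul_assoc]
  rw [e1, mean_pi_prod (β := fun l : V × V => Y l.1)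
    (fun l x => Real.exp (-(y * β l * ind (φ x = 0)))), Finset.mul_sum, ← Finset.sum_neg_distrib,
    Real.exp_sum]
  refine Finset.prod_le_prod (fun l _ => mean_nonneg fun _ => (Real.exp_pos _).le) fun l _ => ?_
  have h2 : 0 ≤ y * β l := mul_nonneg hy0 (h0 l)
  refine (mean_exp_neg_ind_le (fun x : Y l.1 => φ x = 0) h2
    ((mul_le_of_le_one_right hy0 (h1 l)).trans hy1)).trans ?_
  rw [Real.exp_le_exp]
  have h3 := mul_le_mul_of_nonneg_left (half_le_mean_eq_zero (Y l.1) φ) h2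
  linarith

/-- The probability that a node `v` calls a member of `Z`. -/
noncomputable def callProb (Z : Set V) (v : V) : ℝ :=
  mean fun w : {w : V // w ≠ v} => ind ((w : V) ∈ Z)

lemma callProb_nonneg (Z : Set V) (v : V) : 0 ≤ callProb Z v := mean_nonneg fun _ => ind_nonneg _

variable [Nontrivial V]

lemma callProb_le_one (Z : Set V) (v : V) : callProb Z v ≤ 1 :=
  (mean_mono fun _ => ind_le_one _).trans_eq (mean_const 1)

open Classical in
/-- The weight of a node `v` after the calls of the nodes in `S` have been exposed. It is `0` once
`v` has been called. Otherwise it tells whether `v` has called a member of `Z v` if the call of `v` is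
exposed, and it is half the probability of this event if it is not. -/
noncomputable def exposedWeight (Z : V → Set V) (S : Finset V) (c : ∀ u : V, {w : V // w ≠ u})
    (v : V) : ℝ :=
  ind (∀ u ∈ S, (c u : V) ≠ v) *
    if v ∈ S then ind ((c v : V) ∈ Z v) else callProb (Z v) v / 2

lemma exposedWeight_mem (Z : V → Set V) (S : Finset V) (c : ∀ u : V, {w : V // w ≠ u}) (v : V) :
    0 ≤ exposedWeight Z S c v ∧ exposedWeight Z S c v ≤ 1 := by
  have h0 := ind_nonneg (∀ u ∈ S, (c u : V) ≠ v)
  have h1 := ind_le_one (∀ u ∈ S, (c u : V) ≠ v)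
  have h2 := ind_nonneg ((c v : V) ∈ Z v)
  have h3 := ind_le_one ((c v : V) ∈ Z v)
  have h4 := callProb_nonneg (Z v) v
  have h5 := callProb_le_one (Z v) v
  unfold exposedWeight
  split_ifs
  · exact ⟨mul_nonneg h0 h2, mul_le_one₀ h1 h2 h3⟩
  · exact ⟨mul_nonneg h0 (by linarith), mul_le_one₀ h1 (by linarith) (by linarith)⟩

open Classical in
/-- Exposing the call `x` of `u` removes the weight of `x` and resolves the weight of `u`. -/
lemma exposedWeight_insert (Z : V → Set V) {S : Finset V} {u : V} (hu : u ∉ S)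
    (c : ∀ u : V, {w : V // w ≠ u}) (x : {w : V // w ≠ u}) (v : V) :
    exposedWeight Z (insert u S) (Function.update c u x) v =
      exposedWeight Z S c v - ind ((x : V) = v) * exposedWeight Z S c v +
        ind (v = u) * (ind (∀ s ∈ S, (c s : V) ≠ u) *
          (ind ((x : V) ∈ Z u) - callProb (Z u) u / 2)) := by
  have hS : (∀ s ∈ S, ((Function.update c u x s : {w : V // w ≠ s}) : V) ≠ v) ↔
      ∀ s ∈ S, (c s : V) ≠ v := by
    refine forall₂_congr fun s hs => ?_
    rw [Function.update_of_ne (fun h : s = u => hu (h ▸ hs))]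
  have hall : (∀ s ∈ insert u S, ((Function.update c u x s : {w : V // w ≠ s}) : V) ≠ v) ↔
      (x : V) ≠ v ∧ ∀ s ∈ S, (c s : V) ≠ v := by
    rw [Finset.forall_mem_insert, hS, Function.update_self]
  unfold exposedWeight
  rw [hall]
  by_cases hvu : v = u
  · subst hvu
    rw [if_pos (Finset.mem_insert_self v S), if_neg hu, Function.update_self, ind_of_true rfl,
      ind_of_false x.2]
    simp only [ne_eq, x.2, not_false_eq_true, true_and]
    ring
  · rw [ind_of_false hvu, Function.update_of_ne hvu]
    simp only [Finset.mem_insert, hvu, false_or]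
    by_cases hx : (x : V) = v
    · rw [ind_of_true hx, ind_of_false (fun h => h.1 hx)]
      ring
    · rw [ind_of_false hx]
      simp only [ne_eq, hx, not_false_eq_true, true_and]
      ring

/-- Averaging over one more call costs a factor `1 - 4 / (n - 1)` in the exponent. -/
lemma mean_exp_exposedWeight_insert_le (Z : V → Set V) (U : Finset V) {S : Finset V} {u : V}
    (hu : u ∉ S) [DecidableEq V] {r : ℝ} (hr0 : 0 ≤ r) (hr1 : r ≤ 1 / 4)
    (c : ∀ u : V, {w : V // w ≠ u}) :
    mean (fun x : {w : V // w ≠ u} => Real.exp (-(r * ∑ v ∈ U,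
      exposedWeight Z (insert u S) (Function.update c u x) v))) ≤
      Real.exp (-(r * (1 - 4 / (Fintype.card V - 1)) * ∑ v ∈ U, exposedWeight Z S c v)) := by
  have hN := one_le_card_sub_one V
  set N : ℝ := (Fintype.card V : ℝ) - 1 with hNdef
  set w : V → ℝ := exposedWeight Z S c with hw
  set F : ℝ := ∑ v ∈ U, w v with hF
  have hF0 : 0 ≤ F := Finset.sum_nonneg fun v _ => (exposedWeight_mem Z S c v).1
  set b : ℝ := ind (u ∈ U) * ind (∀ s ∈ S, (c s : V) ≠ u) with hb
  have hb0 : 0 ≤ b := mul_nonneg (ind_nonneg _) (ind_nonneg _)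
  have hb1 : b ≤ 1 := mul_le_one₀ (ind_le_one _) (ind_nonneg _) (ind_le_one _)
  let K : {w : V // w ≠ u} → ℝ := fun x => ∑ v ∈ U, ind ((x : V) = v) * w v
  let B : {w : V // w ≠ u} → ℝ := fun x => b * (ind ((x : V) ∈ Z u) - callProb (Z u) u / 2)
  have hsum : ∀ x : {w : V // w ≠ u},
      ∑ v ∈ U, exposedWeight Z (insert u S) (Function.update c u x) v = F - K x + B x := by
    intro x
    have h1 : ∀ v ∈ U, exposedWeight Z (insert u S) (Function.update c u x) v =
        w v - ind ((x : V) = v) * w v + ind (v = u) * (ind (∀ s ∈ S, (c s : V) ≠ u) *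
          (ind ((x : V) ∈ Z u) - callProb (Z u) u / 2)) := by
      intro v _
      rw [hw, ← exposedWeight_insert Z hu c x v]
      congr!
    rw [Finset.sum_congr rfl h1, Finset.sum_add_distrib, Finset.sum_sub_distrib, ← Finset.sum_mul]
    have h2 : ∑ v ∈ U, ind (v = u) = ind (u ∈ U) := by
      by_cases h : u ∈ U
      · rw [Finset.sum_eq_single_of_mem u h fun v _ hv => ind_of_false hv, ind_of_true rfl,
          ind_of_true h]
      · rw [ind_of_false h]
        exact Finset.sum_eq_zero fun v hv => ind_of_false fun e => h (e ▸ hv)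
    rw [h2, ← mul_assoc]
  have hK0 : ∀ x, 0 ≤ K x := fun x => Finset.sum_nonneg fun v _ =>
    mul_nonneg (ind_nonneg _) (exposedWeight_mem Z S c v).1
  have hK1 : ∀ x, K x ≤ 1 := by
    intro x
    by_cases h : (x : V) ∈ U
    · have h1 : K x = w x := by
        refine (Finset.sum_eq_single_of_mem (x : V) h fun v _ hv => ?_).trans ?_
        · rw [ind_of_false (Ne.symm hv), zero_mul]
        · rw [ind_of_true rfl, one_mul]
      rw [h1]
      exact (exposedWeight_mem Z S c x).2
    · refine (Finset.sum_eq_zero fun v hv => ?_).trans_le zero_le_one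
      rw [ind_of_false fun e : (x : V) = v => h (e ▸ hv), zero_mul]
  have hmK : mean K ≤ F / N := by
    rw [mean_sum, hF, Finset.sum_div]
    refine Finset.sum_le_sum fun v _ => ?_
    have h1 : mean (fun x : {w : V // w ≠ u} => ind ((x : V) = v)) ≤ 1 / N := by
      classical
      rw [mean_callTarget u fun x => ind (x = v), sum_ind]
      gcongr
      rw [← Nat.cast_one, Nat.cast_le, Finset.card_le_one]
      intro i hi j hj
      rw [(Finset.mem_filter.1 hi).2, (Finset.mem_filter.1 hj).2]
    have h2 : mean (fun x : {w : V // w ≠ u} => ind ((x : V) = v) * w v) =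
        w v * mean (fun x : {w : V // w ≠ u} => ind ((x : V) = v)) := by
      rw [← mean_const_mul]
      simp only [mul_comm]
    rw [h2, div_eq_mul_one_div]
    exact mul_le_mul_of_nonneg_left h1 (exposedWeight_mem Z S c v).1
  -- the two effects of the call are separated by the inequality between the means
  have hpt : ∀ x : {w : V // w ≠ u}, Real.exp (-(r * ∑ v ∈ U,
      exposedWeight Z (insert u S) (Function.update c u x) v)) ≤
      Real.exp (-(r * F)) * (1 / 2 * (Real.exp (2 * r * K x) + Real.exp (-(2 * r * B x)))) := by
    intro x
    rw [hsum x]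
    have e1 : -(r * (F - K x + B x)) = -(r * F) + (r * K x + -(r * B x)) := by ring
    have e2 : Real.exp (2 * r * K x) = Real.exp (r * K x) ^ 2 := by
      rw [sq, ← Real.exp_add]
      congr 1
      ring
    have e3 : Real.exp (-(2 * r * B x)) = Real.exp (-(r * B x)) ^ 2 := by
      rw [sq, ← Real.exp_add]
      congr 1
      ring
    rw [e1, Real.exp_add, Real.exp_add, e2, e3]
    refine mul_le_mul_of_nonneg_left ?_ (Real.exp_pos _).le
    nlinarith [sq_nonneg (Real.exp (r * K x) - Real.exp (-(r * B x)))]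
  have hE1 : mean (fun x => Real.exp (2 * r * K x)) ≤ Real.exp (4 * r * (F / N)) := by
    have h1 : ∀ x, Real.exp (2 * r * K x) ≤ 1 + 4 * r * K x := by
      intro x
      have := exp_le_one_add_two_mul (y := 2 * r * K x)
        (mul_nonneg (by linarith) (hK0 x)) (by nlinarith [hK0 x, hK1 x])
      linarith
    refine (mean_mono h1).trans ?_
    rw [mean_add, mean_const, mean_const_mul]
    have h2 := mul_le_mul_of_nonneg_left hmK (by linarith : 0 ≤ 4 * r)
    linarith [Real.add_one_le_exp (4 * r * (F / N))]
  have hE2 : mean (fun x => Real.exp (-(2 * r * B x))) ≤ 1 := by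
    have hy0 : 0 ≤ 2 * r * b := by positivity
    have hy1 : 2 * r * b ≤ 1 / 2 := by nlinarith
    have h1 : (fun x => Real.exp (-(2 * r * B x))) = fun x : {w : V // w ≠ u} =>
        Real.exp (2 * r * b * callProb (Z u) u / 2) *
          Real.exp (-(2 * r * b * ind ((x : V) ∈ Z u))) := by
      funext x
      rw [← Real.exp_add]
      congr 1
      simp only [B]
      ring
    rw [h1, mean_const_mul]
    refine (mul_le_mul_of_nonneg_left (mean_exp_neg_ind_le _ hy0 hy1) (Real.exp_pos _).le).trans ?_
    rw [← Real.exp_add]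
    exact (Real.exp_le_one_iff.2 (by rw [callProb]; linarith))
  refine (mean_mono hpt).trans ?_
  rw [mean_const_mul, mean_const_mul, mean_add]
  have hone : 1 ≤ Real.exp (4 * r * (F / N)) :=
    Real.one_le_exp (mul_nonneg (by linarith) (div_nonneg hF0 (by linarith)))
  have e4 : Real.exp (-(r * (1 - 4 / N) * F)) =
      Real.exp (-(r * F)) * Real.exp (4 * r * (F / N)) := by
    rw [← Real.exp_add]
    congr 1
    ring
  rw [e4]
  refine mul_le_mul_of_nonneg_left ?_ (Real.exp_pos _).le
  linarith

/-- Exposing the calls of all nodes in `S` one after the other. -/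
lemma mean_exp_exposedWeight_le (Z : V → Set V) (U S : Finset V)
    (hV : (8 : ℝ) ≤ Fintype.card V - 1) :
    ∀ r : ℝ, 0 ≤ r → r ≤ 1 / 4 →
    mean (fun c : ∀ u : V, {w : V // w ≠ u} =>
      Real.exp (-(r * ∑ v ∈ U, exposedWeight Z S c v))) ≤
      Real.exp (-(r * (1 - 4 / (Fintype.card V - 1)) ^ S.card *
        ∑ v ∈ U, callProb (Z v) v / 2)) := by
  classical
  induction S using Finset.induction_on with
  | empty =>
    intro r _ _
    have h : ∀ c v, exposedWeight Z ∅ c v = callProb (Z v) v / 2 := by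
      intro c v
      simp [exposedWeight, ind_of_true]
    simp only [h, mean_const, Finset.card_empty, pow_zero, mul_one, le_refl]
  | insert u S hu ih =>
    intro r hr0 hr1
    have h4 : 4 / ((Fintype.card V : ℝ) - 1) ≤ 1 := by
      rw [div_le_one (by linarith)]
      linarith
    have h5 : 0 ≤ 4 / ((Fintype.card V : ℝ) - 1) := div_nonneg (by norm_num) (by linarith)
    rw [mean_update u]
    refine (mean_mono fun c => mean_exp_exposedWeight_insert_le Z U hu hr0 hr1 c).trans ?_
    refine (ih (r * (1 - 4 / (Fintype.card V - 1))) (mul_nonneg hr0 (by linarith))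
      ((mul_le_of_le_one_right hr0 (by linarith)).trans hr1)).trans (le_of_eq ?_)
    rw [Finset.card_insert_of_notMem hu, pow_succ]
    congr 1
    ring

open Classical in
/-- The expected number of nodes of `U` that call a node whose packet for them is annihilated is,
as a function of the packets, a weighted sum with weights at most one and total weight `|U|`. -/
lemma exists_packet_weights (rule : PacketRule) (U : Finset V) :
    ∃ β : V × V → ℝ, (∀ l, 0 ≤ β l) ∧ (∀ l, β l ≤ 1) ∧ ∑ l, β l = U.card ∧
      ∀ h : V × V → ℝ, ∑ l, β l * h l =
        ∑ v ∈ U, (∑ u ∈ Finset.univ.erase v, h (packetLink rule (u, v))) /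
          ((Fintype.card V : ℝ) - 1) := by
  have hN := one_le_card_sub_one V
  have hcard : ∀ v : V, ((Finset.univ.erase v).card : ℝ) = Fintype.card V - 1 := by
    intro v
    rw [Finset.card_erase_of_mem (Finset.mem_univ v), Finset.card_univ,
      Nat.cast_sub Fintype.card_pos, Nat.cast_one]
  have hβ : ∀ h : V × V → ℝ, ∑ l, (∑ v ∈ U, (∑ u ∈ Finset.univ.erase v,
      ind (packetLink rule (u, v) = l)) / ((Fintype.card V : ℝ) - 1)) * h l =
        ∑ v ∈ U, (∑ u ∈ Finset.univ.erase v, h (packetLink rule (u, v))) /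
          ((Fintype.card V : ℝ) - 1) := by
    intro h
    simp only [Finset.sum_mul]
    rw [Finset.sum_comm]
    refine Finset.sum_congr rfl fun v _ => ?_
    simp only [div_mul_eq_mul_div, ← Finset.sum_div, Finset.sum_mul]
    rw [Finset.sum_comm]
    simp only [sum_ind_eq_mul]
  refine ⟨fun l => ∑ v ∈ U, (∑ u ∈ Finset.univ.erase v, ind (packetLink rule (u, v) = l)) /
    ((Fintype.card V : ℝ) - 1), ?_, ?_, ?_, hβ⟩
  · intro l
    exact Finset.sum_nonneg fun v _ => div_nonneg (Finset.sum_nonneg fun u _ => ind_nonneg _)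
      (by linarith)
  · intro l
    beta_reduce
    rw [← Finset.sum_div, div_le_one (by linarith)]
    have h1 : ∀ v ∈ U, ∑ u ∈ Finset.univ.erase v, ind (packetLink rule (u, v) = l) ≤
        ind (v ≠ l.1) := by
      intro v _
      have h2 : ∀ u ∈ Finset.univ.erase v, ind (packetLink rule (u, v) = l) ≤ ind (u = l.1) := by
        intro u _
        refine ind_mono fun h => ?_
        rw [← h, packetLink_fst]
      refine (Finset.sum_le_sum h2).trans ?_
      by_cases hv : v = l.1
      · rw [ind_of_false (not_not.2 hv)]
        refine (Finset.sum_eq_zero fun u hu => ind_of_false ?_).le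
        rw [← hv]
        exact Finset.ne_of_mem_erase hu
      · rw [ind_of_true hv, sum_ind, ← Nat.cast_one, Nat.cast_le, Finset.card_le_one]
        intro i hi j hj
        rw [(Finset.mem_filter.1 hi).2, (Finset.mem_filter.1 hj).2]
    refine (Finset.sum_le_sum h1).trans ((Finset.sum_le_univ_sum_of_nonneg fun v =>
      ind_nonneg _).trans (le_of_eq ?_))
    rw [sum_ind, Finset.filter_ne', hcard]
  · have h1 := hβ fun _ => 1
    simp only [mul_one, Finset.sum_const, nsmul_eq_mul, hcard] at h1
    rw [h1, div_self (by linarith), mul_one]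

/-- The factor that the exponent `r` in the Laplace transform `exp (-r |U|)` of the number of ignorant
nodes loses per round. -/
noncomputable def survivalRate : ℝ := Real.exp (-9) / 8

/-- An ignorant node that is not called and calls a node whose packet for it is annihilated stays
ignorant. The packets are exposed first, then the calls one after the other. -/
lemma stepMean_exp_ignorant_le (mode : CallMode) (rule : PacketRule)
    (φ : Module.Dual (ZMod 2) (Fin k → ZMod 2)) (hV : (8 : ℝ) ≤ Fintype.card V - 1) {r : ℝ}
    (hr0 : 0 ≤ r) (hr1 : r ≤ 1 / 4) (Y : GossipState V (ZMod 2) k) :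
    stepMean mode rule (fun Z => Real.exp (-(r * (ignorant φ Z).card))) Y ≤
      Real.exp (-(r * survivalRate * (ignorant φ Y).card)) := by
  classical
  set U := ignorant φ Y with hU
  obtain ⟨β, hβ0, hβ1, hβs, hβ⟩ := exists_packet_weights rule U
  let Z : (∀ l : V × V, Y l.1) → V → Set V := fun p v => {u | φ (sentPacket rule p u v) = 0}
  have hpt : ∀ ω : RoundChoice Y,
      Real.exp (-(r * (ignorant φ (nextState mode rule Y ω)).card)) ≤
      Real.exp (-(r * ∑ v ∈ U, exposedWeight (Z ω.2) Finset.univ ω.1 v)) := by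
    intro ω
    rw [Real.exp_le_exp, neg_le_neg_iff]
    refine mul_le_mul_of_nonneg_left ?_ hr0
    have h1 : ∀ v ∈ U, exposedWeight (Z ω.2) Finset.univ ω.1 v ≤
        ind (v ∈ ignorant φ (nextState mode rule Y ω)) := by
      intro v hv
      by_cases h : v ∈ ignorant φ (nextState mode rule Y ω)
      · rw [ind_of_true h]
        exact (exposedWeight_mem _ _ _ _).2
      · rw [ind_of_false h, exposedWeight, if_pos (Finset.mem_univ v)]
        rw [mem_ignorant_nextState] at h
        push Not at h
        obtain ⟨u, hu, hne⟩ := h hv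
        rcases hu.call with h2 | h2
        · rw [ind_of_false (fun hall => hall u (Finset.mem_univ u) h2), zero_mul]
        · rw [ind_of_false (P := (ω.1 v : V) ∈ Z ω.2 v) (by rw [h2]; exact hne), mul_zero]
    refine (Finset.sum_le_sum h1).trans ?_
    rw [sum_ind, Nat.cast_le]
    exact Finset.card_le_card fun v hv => (Finset.mem_filter.1 hv).2
  have hp : ∀ p : ∀ l : V × V, Y l.1,
      mean (fun c : ∀ u : V, {w : V // w ≠ u} =>
        Real.exp (-(r * ∑ v ∈ U, exposedWeight (Z p) Finset.univ c v))) ≤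
      Real.exp (-(r * Real.exp (-9) / 2 * ∑ l, β l * ind (φ (p l) = 0))) := by
    intro p
    refine (mean_exp_exposedWeight_le (Z p) U Finset.univ hV r hr0 hr1).trans ?_
    have h1 : ∑ l, β l * ind (φ (p l) = 0) = ∑ v ∈ U, callProb (Z p v) v := by
      rw [hβ fun l => ind (φ (p l) = 0)]
      refine Finset.sum_congr rfl fun v _ => ?_
      rw [callProb, mean_callTarget v fun w => ind (w ∈ Z p v)]
      cases rule <;> rfl
    rw [h1, Real.exp_le_exp, neg_le_neg_iff, Finset.card_univ, ← Finset.sum_div]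
    have h2 := exp_neg_nine_le_pow hV
    have h3 : 0 ≤ ∑ v ∈ U, callProb (Z p v) v :=
      Finset.sum_nonneg fun v _ => callProb_nonneg _ _
    have h4 := mul_le_mul_of_nonneg_left (mul_le_mul_of_nonneg_right h2 h3) hr0
    linarith
  refine (mean_mono hpt).trans ?_
  rw [mean_prod, mean_comm]
  refine (mean_mono hp).trans ?_
  have he : Real.exp (-9) ≤ 1 := Real.exp_le_one_iff.2 (by norm_num)
  have he0 := Real.exp_pos (-9)
  refine (mean_exp_packets_le φ Y β hβ0 hβ1 (y := r * Real.exp (-9) / 2) (by positivity)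
    (by nlinarith)).trans (le_of_eq ?_)
  rw [hβs, survivalRate]
  congr 1
  ring

lemma spreadProb_le_exp_ignorant (mode : CallMode) (rule : PacketRule)
    {φ : Module.Dual (ZMod 2) (Fin k → ZMod 2)} (hφ : φ ≠ 0)
    (hV : (8 : ℝ) ≤ Fintype.card V - 1) (A : V → Set (Fin k)) (t : ℕ) :
    spreadProb (ZMod 2) mode rule A t ≤
      Real.exp (-(1 / 4 * survivalRate ^ t * (ignorant φ (initialState (ZMod 2) A)).card)) := by
  have hs0 : 0 ≤ survivalRate := by unfold survivalRate; positivity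
  have hs1 : survivalRate ≤ 1 := by
    have : Real.exp (-9) ≤ 1 := Real.exp_le_one_iff.2 (by norm_num)
    unfold survivalRate
    linarith
  rw [spreadProb_eq_iterate]
  refine iterate_stepMean_le mode rule (fun _ => True) (fun _ _ _ => trivial) _
    (fun s Y => Real.exp (-(1 / 4 * survivalRate ^ s * (ignorant φ Y).card))) ?_ ?_ t _ trivial
  · intro Y _
    by_cases h : ∀ v, Y v = ⊤
    · have h1 : ignorant φ Y = ∅ := by
        refine Finset.eq_empty_of_forall_notMem fun v hv => hφ ?_
        rw [mem_ignorant, h v, top_le_iff] at hv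
        exact LinearMap.ker_eq_top.1 hv
      rw [h1, ind_of_true h]
      simp
    · rw [ind_of_false h]
      positivity
  · intro s Y _
    have h1 : survivalRate ^ s ≤ 1 := pow_le_one₀ hs0 hs1
    refine (stepMean_exp_ignorant_le mode rule φ hV (r := 1 / 4 * survivalRate ^ s)
      (by positivity) (by linarith) Y).trans (le_of_eq ?_)
    rw [pow_succ, mul_assoc (1 / 4 : ℝ)]

end Survival

/-! ### The combined lower bound -/

section Lower

lemma spreadProb_zero {V : Type} [Fintype V] [Nontrivial V] {k : ℕ} (mode : CallMode)
    (rule : PacketRule) (A : V → Set (Fin k)) {v : V}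
    {φ : Module.Dual (ZMod 2) (Fin k → ZMod 2)} (hφ : φ ≠ 0)
    (hv : v ∈ ignorant φ (initialState (ZMod 2) A)) : spreadProb (ZMod 2) mode rule A 0 = 0 := by
  rw [spreadProb_eq_iterate]
  refine ind_of_false fun h => hφ ?_
  rw [mem_ignorant, h v, top_le_iff] at hv
  exact LinearMap.ker_eq_top.1 hv

lemma ncard_le_card_ignorant {V : Type} [Fintype V] {k : ℕ} (A : V → Set (Fin k)) (i : Fin k) :
    {v | i ∉ A v}.ncard ≤ (ignorant (LinearMap.proj i : Module.Dual (ZMod 2) (Fin k → ZMod 2))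
      (initialState (ZMod 2) A)).card := by
  rw [← Set.ncard_coe_finset]
  refine Set.ncard_le_ncard (fun v hv => ?_) (Finset.finite_toSet _)
  rw [Finset.mem_coe, mem_ignorant, initialState, Submodule.span_le]
  rintro _ ⟨j, hj, rfl⟩
  have hij : i ≠ j := fun h => hv (h ▸ hj)
  simp [hij]

lemma proj_ne_zero {k : ℕ} (i : Fin k) :
    (LinearMap.proj i : Module.Dual (ZMod 2) (Fin k → ZMod 2)) ≠ 0 := by
  intro h
  have := LinearMap.congr_fun h (Pi.single i 1)
  simp at this

lemma exists_mul_log_le (a α : ℝ) (ha : 0 < a) (hα : 0 < α) :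
    ∃ n₀ : ℝ, 9 ≤ n₀ ∧ ∀ x : ℝ, n₀ ≤ x → a * Real.log x ≤ α / 4 * x ^ (1 / 2 : ℝ) := by
  have h := (isLittleO_log_rpow_atTop (r := 1 / 2) (by norm_num)).bound
    (c := α / 4 / a) (by positivity)
  obtain ⟨n₁, h₁⟩ := Filter.eventually_atTop.1 h
  refine ⟨max n₁ 9, le_max_right _ _, fun x hx => ?_⟩
  have h2 := h₁ x ((le_max_left _ _).trans hx)
  have hx0 : 0 ≤ x := by linarith [(le_max_right n₁ 9).trans hx]
  rw [Real.norm_eq_abs, Real.norm_eq_abs, abs_of_nonneg (Real.rpow_nonneg hx0 _)] at h2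
  calc a * Real.log x ≤ a * (α / 4 / a * x ^ (1 / 2 : ℝ)) := by
        gcongr
        exact (le_abs_self _).trans h2
    _ = _ := by field_simp

lemma exists_lower_bound (mode : CallMode) (rule : PacketRule) (a : ℝ) (ha : 0 < a) (α : ℝ)
    (hα : 0 < α) :
    ∃ c : ℝ, 0 < c ∧
      ∀ (V : Type) [Fintype V] [Nontrivial V] (k : ℕ) (A : V → Set (Fin k)),
        (∃ v, α * (k : ℝ) ≤ ({i | i ∉ A v}.ncard : ℝ)) →
        (∃ i, α * (Fintype.card V : ℝ) ≤ ({v | i ∉ A v}.ncard : ℝ)) →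
        ∀ t : ℕ, (t : ℝ) < c * ((k : ℝ) + Real.log (Fintype.card V)) →
          spreadProb (ZMod 2) mode rule A t ≤ (Fintype.card V : ℝ) ^ (-a) := by
  obtain ⟨n₀, hn₀, hlog⟩ := exists_mul_log_le a α ha hα
  set b : ℝ := 2 * a / α with hb
  have hb0 : 0 < b := by positivity
  have hbe : 0 < b + Real.exp b := by positivity
  have hs0 : 0 < survivalRate := by unfold survivalRate; positivity
  have hs1 : survivalRate < 1 := by
    have : Real.exp (-9) ≤ 1 := Real.exp_le_one_iff.2 (by norm_num)
    unfold survivalRate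
    linarith
  have hd : 0 < -Real.log survivalRate := by
    have := Real.log_neg hs0 hs1
    linarith
  have hl0 : 0 < Real.log n₀ := Real.log_pos (by linarith)
  -- the three bounds serve `log n ≤ k`, large `n` with `k < log n`, and small `n` with `k < log n`;
  -- the factors `2` come from `k + log n ≤ 2 * max k (log n)`
  obtain ⟨c, hc0, hc⟩ : ∃ c : ℝ, 0 < c ∧ 2 * c * (b + Real.exp b) ≤ a ∧
      2 * c * -Real.log survivalRate ≤ 1 / 2 ∧ 2 * c * Real.log n₀ ≤ 1 := by
    refine ⟨min (a / (2 * (b + Real.exp b))) (min (1 / (4 * -Real.log survivalRate))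
      (1 / (2 * Real.log n₀))), by positivity, ?_, ?_, ?_⟩
    · have h := min_le_left (a / (2 * (b + Real.exp b))) (min (1 / (4 * -Real.log survivalRate))
        (1 / (2 * Real.log n₀)))
      rw [le_div_iff₀ (by positivity)] at h
      linarith
    · have h := (min_le_right (a / (2 * (b + Real.exp b))) (min (1 / (4 * -Real.log survivalRate))
        (1 / (2 * Real.log n₀)))).trans (min_le_left _ _)
      rw [le_div_iff₀ (by positivity)] at h
      linarith
    · have h := (min_le_right (a / (2 * (b + Real.exp b))) (min (1 / (4 * -Real.log survivalRate))
        (1 / (2 * Real.log n₀)))).trans (min_le_right _ _)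
      rw [le_div_iff₀ (by positivity)] at h
      linarith
  obtain ⟨hc1, hc2, hc3⟩ := hc
  refine ⟨c, hc0, ?_⟩
  rintro V _ _ k A ⟨v, hv⟩ ⟨i, hi⟩ t ht
  have hN := one_le_card_sub_one V
  set n : ℝ := (Fintype.card V : ℝ) with hn
  have hn0 : 0 < n := by linarith
  have hL : 0 ≤ Real.log n := Real.log_nonneg (by linarith)
  rw [Real.rpow_def_of_pos hn0]
  rcases le_total (Real.log n) k with hk | hk
  · refine (spreadProb_le_exp_finrank mode rule A v hb0.le t).trans ?_
    rw [Real.exp_le_exp]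
    have h1 : (t : ℝ) * (b + Real.exp b) ≤ a * k := by
      have h2 : (t : ℝ) ≤ 2 * c * k := by nlinarith
      have h3 := mul_le_mul_of_nonneg_right h2 hbe.le
      have h4 := mul_le_mul_of_nonneg_right hc1 (Nat.cast_nonneg k : (0 : ℝ) ≤ k)
      linarith
    have h5 := mul_le_mul_of_nonneg_left hv hb0.le
    have h6 : b * (α * k) = 2 * a * k := by
      rw [hb]
      field_simp
    have h7 := mul_le_mul_of_nonneg_left hk ha.le
    linarith
  · have ht' : (t : ℝ) ≤ 2 * c * Real.log n := by nlinarith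
    have hU : α * n ≤ (ignorant (LinearMap.proj i : Module.Dual (ZMod 2) (Fin k → ZMod 2))
        (initialState (ZMod 2) A)).card :=
      hi.trans (by exact_mod_cast ncard_le_card_ignorant A i)
    rcases le_or_gt n₀ n with hn' | hn'
    · refine (spreadProb_le_exp_ignorant mode rule (proj_ne_zero i) (by linarith) A t).trans ?_
      rw [Real.exp_le_exp]
      have h1 : n ^ (-(1 / 2) : ℝ) ≤ survivalRate ^ t := by
        rw [Real.rpow_def_of_pos hn0, ← Real.exp_log (pow_pos hs0 t), Real.log_pow,
          Real.exp_le_exp]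
        have h2 := mul_le_mul_of_nonneg_right ht' hd.le
        have h3 := mul_le_mul_of_nonneg_right hc2 hL
        linarith
      have h4 : n ^ (1 / 2 : ℝ) = n ^ (-(1 / 2) : ℝ) * n := by
        rw [← Real.rpow_add_one hn0.ne']
        norm_num
      have h5 := hlog n hn'
      have h6 : n ^ (-(1 / 2) : ℝ) * (α * n) ≤ survivalRate ^ t *
          (ignorant (LinearMap.proj i : Module.Dual (ZMod 2) (Fin k → ZMod 2))
            (initialState (ZMod 2) A)).card :=
        mul_le_mul h1 hU (by positivity) (by positivity)
      rw [h4] at h5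
      linarith
    · -- few nodes: the time bound only admits `t = 0`
      have h1 : (t : ℝ) < 1 := by
        have h2 : Real.log n < Real.log n₀ := Real.log_lt_log hn0 hn'
        have h3 := mul_lt_mul_of_pos_left h2 (by positivity : 0 < 2 * c)
        linarith
      have h2 : t = 0 := by
        have : t < 1 := by exact_mod_cast h1
        omega
      have h3 : 0 < (ignorant (LinearMap.proj i : Module.Dual (ZMod 2) (Fin k → ZMod 2))
          (initialState (ZMod 2) A)).card := by
        have : (0 : ℝ) < α * n := by positivity
        exact_mod_cast this.trans_le hU
      obtain ⟨v, hv⟩ := Finset.card_pos.1 h3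
      rw [h2, spreadProb_zero mode rule A (proj_ne_zero i) hv]
      positivity

end Lower

theorem lemma2 (mode : CallMode) (rule : PacketRule) (a : ℝ) (ha : 0 < a) :
    (∃ C : ℝ, 0 < C ∧
      ∀ (V : Type) [Fintype V] [Nontrivial V] (k : ℕ) (A : V → Set (Fin k)),
        (∀ i, ∃ v, i ∈ A v) →
        ∀ t : ℕ, C * ((k : ℝ) + Real.log (Fintype.card V)) ≤ (t : ℝ) →
          1 - (Fintype.card V : ℝ) ^ (-a) ≤ spreadProb (ZMod 2) mode rule A t) ∧
    (∀ α : ℝ, 0 < α → ∃ c : ℝ, 0 < c ∧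
      ∀ (V : Type) [Fintype V] [Nontrivial V] (k : ℕ) (A : V → Set (Fin k)),
        (∀ i, ∃ v, i ∈ A v) →
        (∃ v, α * (k : ℝ) ≤ ({i | i ∉ A v}.ncard : ℝ)) →
        (∃ i, α * (Fintype.card V : ℝ) ≤ ({v | i ∉ A v}.ncard : ℝ)) →
        ∀ t : ℕ, (t : ℝ) < c * ((k : ℝ) + Real.log (Fintype.card V)) →
          spreadProb (ZMod 2) mode rule A t ≤ (Fintype.card V : ℝ) ^ (-a)) := by
  refine ⟨exists_upper_bound mode rule a ha, fun α hα => ?_⟩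
  obtain ⟨c, hc0, hc⟩ := exists_lower_bound mode rule a ha α hα
  exact ⟨c, hc0, fun V _ _ k A _ => hc V k A⟩
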